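/- Let $0<p<\infty$ and $\alpha>-1$. For $0<s<\infty$ let $A^s_\alpha$ denote the weighted Bergman space of analytic functions $f$ in the unit disc $\mathbb D$ with $$\|f\|_{A^s_\alpha}=\Big((\alpha+1)\int_{\mathbb D}|f(z)|^s(1-|z|^2)^\alpha\,dA(z)\Big)^{1/s}<\infty,\qquad dA=\tfrac1\pi\,dx\,dy .$$ A positive Borel measure $\mu$ on $[0,1)$ is an $s$-Carleson measure if there is $C>0$ with $\mu([t,1))\le C(1-t)^s$ for all $0\le t<1$, and a $1$-logarithmic $s$-Carleson measure if there is $C>0$ with $\mu([t,1))\log\frac{2}{1-t}\le C(1-t)^s$ for all $0\le t<1$. Let $\mu$ be a positive Borel measure on $[0,1)$ such that: $\mu$ is an $\frac{\alpha+2}{p}$-Carleson measure if $0<p\le 1$; $\mu$ is an $\frac{\alpha+2-(p-1)^2}{p}$-Carleson measure if $1\le p\le 2$; $\mu$ is an $\frac{\alpha+1}{p}$-Carleson measure if $2\le p<\infty$. For $\beta>0$ and $f(z)=\sum_{k\ge0}a_kz^k$ analytic in $\mathbb D$, put $$\mathcal H_{\mu,\beta}(f)(z)=\sum_{n=0}^\infty\Big(\sum_{k=0}^\infty\mu_{n,k,\beta}\,a_k\Big)z^n,\qquad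 \mu_{n,k,\beta}=\int_{[0,1)}\frac{\Gamma(n+\beta)}{n!\,\Gamma(\beta)}\,t^{n+k}\,d\mu(t),$$ whenever these series converge for every $n$ and every $z\in\mathbb D$, so that they define an analytic function in $\mathbb D$. The operator $\mathcal H_{\mu,\beta}$ is called bounded from $A^p_\alpha$ into $A^q_\alpha$ if it is defined on all of $A^p_\alpha$, maps it into $A^q_\alpha$, and there is a finite constant $C$ with $\|\mathcal H_{\mu,\beta}(f)\|_{A^q_\alpha}\le C\|f\|_{A^p_\alpha}$ for all $f\in A^p_\alpha$. Then: (i) For every $q\ge p$ with $1<q<\infty$, with $\frac1q+\frac1{q'}=1$, the operator $\mathcal H_{\mu,\alpha+2}$ is bounded from $A^p_\alpha$ into $A^q_\alpha$ if and only if $\mu$ is a $\left(\frac{\alpha+2}{p}+\frac{\alpha+2}{q'}\right)$-Carleson measure. (ii) If $p\le 1$, the operator $\mathcal H_{\mu,\alpha+2}$ is bounded from $A^p_\alpha$ into $A^1_\alpha$ if and only if $\mu$ is a $1$-logarithmic $\frac{\alpha+2}{p}$-Carleson measure. -/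

import Mathlib

open MeasureTheory Filter Topology
open scoped ENNReal NNReal

/-- The (quasi-)norm of the weighted Bergman space `A^p_α` of the unit disc, with values in
`[0, ∞]`: `((α + 1) ∫_𝔻 |f z|^p (1 - |z|^2)^α dA(z))^(1/p)`, where `dA = dx dy / π`. -/
noncomputable def bergmanNorm (p α : ℝ) (f : ℂ → ℂ) : ℝ≥0∞ :=
  (ENNReal.ofReal ((α + 1) / Real.pi) *
    ∫⁻ z in Metric.ball (0 : ℂ) 1,
      ENNReal.ofReal (‖f z‖ ^ p * (1 - ‖z‖ ^ 2) ^ α)) ^ (1 / p)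

/-- Membership in the weighted Bergman space `A^p_α`: analytic in the unit disc with finite norm.
Only the values of `f` in the unit disc matter. -/
def MemBergman (p α : ℝ) (f : ℂ → ℂ) : Prop :=
  DifferentiableOn ℂ f (Metric.ball (0 : ℂ) 1) ∧ bergmanNorm p α f < ∞

/-- The `k`-th Taylor coefficient of `f` at the origin. -/
noncomputable def taylorCoeffZero (f : ℂ → ℂ) (k : ℕ) : ℂ :=
  iteratedDeriv k f 0 / (k.factorial : ℂ)

/-- The entry `μ_{n,k,β} = ∫_{[0,1)} Γ(n+β) / (n! Γ(β)) t^(n+k) dμ(t)` of the generalized Hankel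
matrix of a positive Borel measure `μ` on `[0,1)`. -/
noncomputable def hankelEntry (μ : Measure (Set.Ico (0 : ℝ) 1)) (β : ℝ) (n k : ℕ) : ℝ :=
  ∫ t, Real.Gamma (n + β) / (n.factorial * Real.Gamma β) * (t : ℝ) ^ (n + k) ∂μ

/-- `g` is the image of `f` under the generalized Hilbert operator `H_{μ,β}`, that is,
`∑_n (∑_k μ_{n,k,β} a_k) z^n`, with `a_k` the Taylor coefficients of `f`, makes sense and defines
the analytic function `g` in the unit disc: the matrix entries are finite, each inner series
converges (as the limit of its partial sums), and the power series converges to `g` in the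
disc. -/
structure IsHilbertImage (μ : Measure (Set.Ico (0 : ℝ) 1)) (β : ℝ) (f g : ℂ → ℂ) : Prop where
  integrable_entry : ∀ m : ℕ, Integrable (fun t : Set.Ico (0 : ℝ) 1 => (t : ℝ) ^ m) μ
  analytic : DifferentiableOn ℂ g (Metric.ball (0 : ℂ) 1)
  exists_coeff : ∃ b : ℕ → ℂ,
    (∀ n : ℕ, Tendsto
      (fun N : ℕ => ∑ k ∈ Finset.range N, (hankelEntry μ β n k : ℂ) * taylorCoeffZero f k)
      atTop (𝓝 (b n))) ∧
    ∀ z ∈ Metric.ball (0 : ℂ) 1, HasSum (fun n : ℕ => b n * z ^ n) (g z)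

/-- `H_{μ,β}` is a bounded operator from `A^p_α` into `A^q_γ`: it is well defined on all of
`A^p_α`, takes values in `A^q_γ`, and `‖H_{μ,β} f‖ ≤ C ‖f‖` with a finite constant `C`. -/
def HilbertBounded (μ : Measure (Set.Ico (0 : ℝ) 1)) (β p α q γ : ℝ) : Prop :=
  ∃ C : ℝ≥0, ∀ f : ℂ → ℂ, MemBergman p α f →
    ∃ g : ℂ → ℂ, IsHilbertImage μ β f g ∧ MemBergman q γ g ∧
      bergmanNorm q γ g ≤ (C : ℝ≥0∞) * bergmanNorm p α f

/-- A positive Borel measure `μ` on `[0,1)` is an `s`-Carleson measure: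
`μ([t,1)) ≤ C (1-t)^s` for `0 ≤ t < 1`. -/
def IsCarleson (μ : Measure (Set.Ico (0 : ℝ) 1)) (s : ℝ) : Prop :=
  ∃ C : ℝ, 0 < C ∧ ∀ t : Set.Ico (0 : ℝ) 1,
    μ (Set.Ici t) ≤ ENNReal.ofReal (C * (1 - (t : ℝ)) ^ s)

/-- A positive Borel measure `μ` on `[0,1)` is a `γ`-logarithmic `s`-Carleson measure:
`μ([t,1)) (log (2 / (1-t)))^γ ≤ C (1-t)^s` for `0 ≤ t < 1`. -/
def IsLogCarleson (μ : Measure (Set.Ico (0 : ℝ) 1)) (γ s : ℝ) : Prop :=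
  ∃ C : ℝ, 0 < C ∧ ∀ t : Set.Ico (0 : ℝ) 1,
    μ (Set.Ici t) * ENNReal.ofReal (Real.log (2 / (1 - (t : ℝ))) ^ γ) ≤
      ENNReal.ofReal (C * (1 - (t : ℝ)) ^ s)

/-- The standing Carleson-type condition on `μ` relative to `A^p_α`. The cases agree where they
overlap (`p = 1` and `p = 2`). -/
def StandingCarleson (μ : Measure (Set.Ico (0 : ℝ) 1)) (p α : ℝ) : Prop :=
  (p ≤ 1 → IsCarleson μ ((α + 2) / p)) ∧
  (1 ≤ p → p ≤ 2 → IsCarleson μ ((α + 2 - (p - 1) ^ 2) / p)) ∧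
  (2 ≤ p → IsCarleson μ ((α + 1) / p))

/-! Write β = α + 2. Summing the binomial series turns the operator into `hilbertIntegral`, the
integral of f(t)(1 - tz)^(-β) against μ, and both directions reduce to counting powers of 2 on
dyadic pieces near the boundary point 1.

Sufficiency. Where 1 - t ~ 2^(-j), the sub-mean value property gives |f(t)| ≤ d_j 2^(jβ/p) with Σ
d_j^p ≲ ‖f‖^p (`exists_dyadic_bound`). Where |1 - z| ~ 2^(-i), the kernel is at most a constant
times max(2^(-i), 2^(-j))^(-β), and that shell has weighted area O(2^(-iβ)). If q > 1, the Carleson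
bound on μ leaves a matrix dominated by r^|i-j| with r < 1; Schur's test on ℓ^q
(`tsum_tsum_mul_rpow_le`) and ℓ^p ⊂ ℓ^q finish. If q = 1, summing over i first produces a factor j +
1 (`tsum_half_pow_max_le`), which is exactly what the logarithm in the Carleson condition absorbs.

Necessity. The operator is applied to (1 - az)^(-M) with a = 1 - 2^(-N). At the points 1 - 2^(-j), j
≤ N, the image is at least a constant times 2^(NM) 2^(jβ) μ([a,1)). The sub-mean value property on
boundedly overlapping annuli adds these contributions (`HilbertBounded.exists_measure_Ici_le`). For
q > 1 the term j = N suffices; for q = 1 all N + 1 terms count equally and give the logarithm.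

Convergence of the defining series is controlled by Σ |a_k| t^k (`coeffMajorant`). Its integral
against an s-Carleson measure is bounded by the area integral of |f| with weight (1 - |z|²)^(s-2),
which is finite by embeddings of A^p_α. -/

/-! ### Sub-mean value properties and polar coordinates. -/

/-- The sub-mean value property of `‖f‖ ^ p` on circles, for every exponent `p > 0`. -/
theorem norm_rpow_le_circleAverage {f : ℂ → ℂ} {c : ℂ} {r p : ℝ} (hr : 0 < r) (hp : 0 < p)
    (hf : AnalyticOnNhd ℂ f (Metric.closedBall c r)) :
    ‖f c‖ ^ p ≤ Real.circleAverage (fun z => ‖f z‖ ^ p) c r := by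
  have hsub : Metric.sphere c |r| ⊆ Metric.closedBall c r := by
    rw [abs_of_pos hr]; exact Metric.sphere_subset_closedBall
  have hcont : ContinuousOn (fun z => ‖f z‖ ^ p) (Metric.sphere c |r|) :=
    ((hf.continuousOn.mono hsub).norm).rpow_const fun _ _ => Or.inr hp.le
  have hint : CircleIntegrable (fun z => ‖f z‖ ^ p) c r := by
    apply ContinuousOn.circleIntegrable'
    simpa using hcont
  by_cases h0 : f c = 0
  · rw [h0, norm_zero, Real.zero_rpow hp.ne']
    exact Real.circleAverage_nonneg_of_nonneg fun z _ => by positivity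
  set a := ‖f c‖ with ha
  have ha0 : 0 < a := norm_pos_iff.2 h0
  have hmero : MeromorphicOn f (Metric.sphere c |r|) := (hf.mono hsub).meromorphicOn
  have hlog : CircleIntegrable (fun z => Real.log ‖f z‖) c r := hmero.circleIntegrable_log_norm
  have hJ : Real.log a ≤ Real.circleAverage (fun z => Real.log ‖f z‖) c r := by
    have hf' : AnalyticOnNhd ℂ f (Metric.closedBall c |r|) := by rwa [abs_of_pos hr]
    rw [hf'.circleAverage_log_norm hr.ne' h0]
    have : 0 ≤ ∑ᶠ u, (MeromorphicOn.divisor f (Metric.closedBall c |r|) u : ℝ)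
        * Real.log (r * ‖c - u‖⁻¹) := by
      apply finsum_nonneg
      intro u
      by_cases hu : u ∈ Metric.closedBall c |r|
      · refine mul_nonneg ?_ ?_
        · exact_mod_cast MeromorphicOn.AnalyticOnNhd.divisor_nonneg hf' u
        · rw [abs_of_pos hr, mem_closedBall_iff_norm'] at hu
          rcases (norm_nonneg (c - u)).eq_or_lt with h | h
          · simp [← h]
          · apply Real.log_nonneg
            rw [← div_eq_mul_inv, one_le_div h]
            exact hu
      · simp [hu]
    linarith
  -- Tangent line at log a of the convex function u ↦ exp(pu), evaluated at u = log |f|. It lies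
  -- below |f|^p off the zeros, and its average is at least a^p by Jensen's inequality `hJ`.
  set φ : ℂ → ℝ := fun z => a ^ p * (1 - p * Real.log a) + (a ^ p * p) • Real.log ‖f z‖ with hφ
  have hφi : CircleIntegrable φ c r := by
    exact (circleIntegrable_const _ _ _).add (hlog.const_smul)
  have hφavg : a ^ p ≤ Real.circleAverage φ c r := by
    rw [hφ, Real.circleAverage_fun_add (circleIntegrable_const _ _ _) 
      (f₂ := fun z => (a ^ p * p) • Real.log ‖f z‖) (hlog.const_smul),
      Real.circleAverage_const, Real.circleAverage_fun_smul, smul_eq_mul]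
    have : a ^ p * p * Real.log a ≤
        a ^ p * p * Real.circleAverage (fun z => Real.log ‖f z‖) c r := by gcongr
    linarith
  have hcod : {z | f z ≠ 0} ∈ codiscreteWithin (Metric.sphere c |r|) := by
    have h1 : {z | f z ≠ 0} ∈ codiscreteWithin (Metric.closedBall c r) := by
      have := hf.preimage_zero_mem_codiscreteWithin (x := c) h0 (by simp [hr.le])
        ((convex_closedBall c r).isConnected (by simp [hr.le]))
      simpa [Set.preimage, Set.compl_def] using this
    exact Filter.codiscreteWithin_mono hsub h1
  -- At a zero of f the convention log 0 = 0 may push φ above |f|^p = 0. Zeros form a discrete set,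
  -- so replacing the value there leaves the average unchanged.
  set ψ : ℂ → ℝ := fun z => if f z = 0 then 0 else φ z with hψ
  have hφψ : φ =ᶠ[codiscreteWithin (Metric.sphere c |r|)] ψ := by
    filter_upwards [hcod] with z hz
    simp [hψ, show f z ≠ 0 from hz]
  have hψi : CircleIntegrable ψ c r := hφi.congr_codiscreteWithin hφψ
  calc a ^ p ≤ Real.circleAverage φ c r := hφavg
    _ = Real.circleAverage ψ c r := Real.circleAverage_congr_codiscreteWithin hφψ hr.ne'
    _ ≤ _ := by
      apply Real.circleAverage_mono hψi hint
      intro z _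
      simp only [hψ, hφ]
      split_ifs with hz
      · positivity
      · have hy : 0 < ‖f z‖ := norm_pos_iff.2 hz
        have h1 := Real.add_one_le_exp (p * (Real.log ‖f z‖ - Real.log a))
        have h2 : ‖f z‖ ^ p = a ^ p * Real.exp (p * (Real.log ‖f z‖ - Real.log a)) := by
          rw [Real.rpow_def_of_pos hy, Real.rpow_def_of_pos ha0, ← Real.exp_add]
          ring_nf
        rw [h2, smul_eq_mul]
        have h3 : 0 < a ^ p := by positivity
        nlinarith [mul_le_mul_of_nonneg_left h1 h3.le]

theorem lintegral_eq_lintegral_circleMap {F : ℂ → ℝ≥0∞} (hF : Measurable F) (c : ℂ) :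
    ∫⁻ z, F z = ∫⁻ r in Set.Ioi (0 : ℝ), ENNReal.ofReal r *
      ∫⁻ θ in Set.Ioo (-Real.pi) Real.pi, F (circleMap c r θ) := by
  have h1 : ∫⁻ z, F z = ∫⁻ z, F (c + z) := (lintegral_add_left_eq_self F c).symm
  rw [h1, ← Complex.lintegral_comp_polarCoord_symm, polarCoord_target,
    Measure.volume_eq_prod, ← Measure.prod_restrict]
  have h2 : ∀ q : ℝ × ℝ, c + Complex.polarCoord.symm q = circleMap c q.1 q.2 := by
    intro q
    simp [circleMap, Complex.exp_mul_I]
  simp_rw [h2]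
  have hm : Measurable fun q : ℝ × ℝ => F (circleMap c q.1 q.2) := by
    apply hF.comp
    unfold circleMap
    fun_prop
  have hm' : Measurable fun q : ℝ × ℝ => ENNReal.ofReal q.1 • F (circleMap c q.1 q.2) :=
    (by fun_prop : Measurable fun q : ℝ × ℝ => ENNReal.ofReal q.1).smul hm
  rw [lintegral_prod _ hm'.aemeasurable]
  apply lintegral_congr
  intro r
  simp only [smul_eq_mul]
  rw [lintegral_const_mul]
  exact hm.comp measurable_prodMk_left

theorem lintegral_ofReal_circleMap {φ : ℂ → ℝ} {c : ℂ} {r : ℝ}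
    (hφ : ContinuousOn φ (Metric.sphere c |r|)) (h0 : ∀ z, 0 ≤ φ z) :
    ∫⁻ θ in Set.Ioo (-Real.pi) Real.pi, ENNReal.ofReal (φ (circleMap c r θ)) =
      ENNReal.ofReal (2 * Real.pi * Real.circleAverage φ c r) := by
  have hc : Continuous fun θ => φ (circleMap c r θ) :=
    hφ.comp_continuous (continuous_circleMap c r) fun θ => circleMap_mem_sphere' c r θ
  have h1 : 2 * Real.pi * Real.circleAverage φ c r =
      ∫ θ in (-Real.pi)..Real.pi, φ (circleMap c r θ) := by
    rw [Real.circleAverage, smul_eq_mul, ← mul_assoc, mul_inv_cancel₀ (by positivity), one_mul]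
    have t₀ : (fun θ ↦ φ (circleMap c r θ)).Periodic (2 * Real.pi) :=
      fun x ↦ by simp [periodic_circleMap c r x]
    have := t₀.intervalIntegral_add_eq 0 (-Real.pi)
    rw [zero_add] at this
    rw [this]
    congr 1
    ring
  rw [h1, intervalIntegral.integral_of_le (by linarith [Real.pi_pos]),
    restrict_Ioo_eq_restrict_Ioc, ofReal_integral_eq_lintegral_ofReal]
  · exact (hc.intervalIntegrable _ _).1
  · exact Eventually.of_forall fun _ => h0 _

/-- A lower bound for circle averages integrates to a lower bound over an annulus. -/
theorem le_setLIntegral_annulus {φ : ℂ → ℝ} {c : ℂ} {a b m : ℝ} (ha : 0 ≤ a) (hab : a ≤ b)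
    (hm0 : 0 ≤ m)
    (hφ : ContinuousOn φ {z | ‖z - c‖ ∈ Set.Ioo a b}) (h0 : ∀ z, 0 ≤ φ z)
    (hm : ∀ r ∈ Set.Ioo a b, m ≤ Real.circleAverage φ c r) :
    ENNReal.ofReal (m * (Real.pi * (b ^ 2 - a ^ 2))) ≤
      ∫⁻ z in {z | ‖z - c‖ ∈ Set.Ioo a b}, ENNReal.ofReal (φ z) := by
  have hmeas : MeasurableSet {z : ℂ | ‖z - c‖ ∈ Set.Ioo a b} :=
    measurableSet_Ioo.preimage (by fun_prop)
  rw [← lintegral_indicator hmeas]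
  have hF : Measurable ({z : ℂ | ‖z - c‖ ∈ Set.Ioo a b}.indicator
      fun z => ENNReal.ofReal (φ z)) := by
    have h := ContinuousOn.measurable_piecewise (f := fun z => ENNReal.ofReal (φ z))
      (g := 0) (ENNReal.continuous_ofReal.comp_continuousOn hφ)
      continuousOn_const hmeas
    rwa [Set.piecewise_eq_indicator] at h
  rw [lintegral_eq_lintegral_circleMap hF c]
  calc ENNReal.ofReal (m * (Real.pi * (b ^ 2 - a ^ 2)))
      = ∫⁻ r in Set.Ioo a b, ENNReal.ofReal (r * (2 * Real.pi * m)) := by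
        rw [restrict_Ioo_eq_restrict_Ioc, ← ofReal_integral_eq_lintegral_ofReal,
          ← intervalIntegral.integral_of_le hab, intervalIntegral.integral_mul_const,
          integral_id]
        · congr 1; ring
        · exact ((by fun_prop : Continuous fun r : ℝ => r * (2 * Real.pi * m)).intervalIntegrable
            a b).1
        · rw [EventuallyLE, ae_restrict_iff' measurableSet_Ioc]
          filter_upwards with r hr
          have : 0 ≤ r := ha.trans hr.1.le
          simp only [Pi.zero_apply]; positivity
    _ ≤ ∫⁻ r in Set.Ioo a b, ENNReal.ofReal r *
      ∫⁻ θ in Set.Ioo (-Real.pi) Real.pi, ({z : ℂ | ‖z - c‖ ∈ Set.Ioo a b}.indicator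
      fun z => ENNReal.ofReal (φ z)) (circleMap c r θ) := by
        apply setLIntegral_mono' measurableSet_Ioo
        intro r hr
        have hr0 : 0 ≤ r := ha.trans hr.1.le
        rw [ENNReal.ofReal_mul hr0]
        gcongr
        have : ∀ θ, ({z : ℂ | ‖z - c‖ ∈ Set.Ioo a b}.indicator
            fun z => ENNReal.ofReal (φ z)) (circleMap c r θ) =
            ENNReal.ofReal (φ (circleMap c r θ)) := by
          intro θ
          apply Set.indicator_of_mem
          simpa [abs_of_nonneg hr0, circleMap] using hr
        simp_rw [this]
        rw [lintegral_ofReal_circleMap (hφ.mono _) h0]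
        · gcongr
          exact hm r hr
        · intro z hz
          rw [abs_of_nonneg hr0, mem_sphere_iff_norm] at hz
          simpa [hz] using hr
    _ ≤ _ := lintegral_mono_set fun r hr => ha.trans_lt hr.1

/-- The sub-mean value property of `‖f‖ ^ p` on discs, for every exponent `p > 0`. -/
theorem norm_rpow_mul_le_setLIntegral {f : ℂ → ℂ} {c : ℂ} {ρ p : ℝ} (hρ : 0 ≤ ρ) (hp : 0 < p)
    (hf : DifferentiableOn ℂ f (Metric.ball c ρ)) :
    ENNReal.ofReal (‖f c‖ ^ p * (Real.pi * ρ ^ 2)) ≤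
      ∫⁻ z in Metric.ball c ρ, ENNReal.ofReal (‖f z‖ ^ p) := by
  have hsub : {z | ‖z - c‖ ∈ Set.Ioo 0 ρ} ⊆ Metric.ball c ρ := fun z hz => by
    rw [mem_ball_iff_norm]; exact hz.2
  have h := le_setLIntegral_annulus (φ := fun z => ‖f z‖ ^ p) (c := c) (m := ‖f c‖ ^ p) le_rfl hρ
    (by positivity)
    (((hf.continuousOn.mono hsub).norm).rpow_const fun _ _ => Or.inr hp.le)
    (fun z => by positivity) (fun r hr => norm_rpow_le_circleAverage hr.1 hp
      ((hf.analyticOnNhd Metric.isOpen_ball).mono (Metric.closedBall_subset_ball hr.2)))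
  calc _ = ENNReal.ofReal (‖f c‖ ^ p * (Real.pi * (ρ ^ 2 - 0 ^ 2))) := by ring_nf
    _ ≤ _ := h
    _ ≤ _ := lintegral_mono_set hsub

/-! ### The weighted area and dyadic annuli. -/

/-- The (unnormalized) weighted area measure `(1 - |z|²)^α dx dy` on the unit disc. -/
noncomputable def weightedArea (α : ℝ) : Measure ℂ :=
  (volume.restrict (Metric.ball (0 : ℂ) 1)).withDensity
    fun z => ENNReal.ofReal ((1 - ‖z‖ ^ 2) ^ α)

theorem setLIntegral_weightedArea (α : ℝ) (F : ℂ → ℝ≥0∞) {s : Set ℂ} (hs : MeasurableSet s) :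
    ∫⁻ z in s, F z ∂weightedArea α =
      ∫⁻ z in s ∩ Metric.ball 0 1, ENNReal.ofReal ((1 - ‖z‖ ^ 2) ^ α) * F z := by
  rw [weightedArea, restrict_withDensity hs, Measure.restrict_restrict hs,
    lintegral_withDensity_eq_lintegral_mul_non_measurable]
  · rfl
  · fun_prop
  · exact Eventually.of_forall fun _ => ENNReal.ofReal_lt_top

theorem lintegral_weightedArea (α : ℝ) (F : ℂ → ℝ≥0∞) :
    ∫⁻ z, F z ∂weightedArea α =
      ∫⁻ z in Metric.ball 0 1, ENNReal.ofReal ((1 - ‖z‖ ^ 2) ^ α) * F z := by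
  simpa using setLIntegral_weightedArea α F MeasurableSet.univ

theorem weightedArea_compl_ball (α : ℝ) : weightedArea α (Metric.ball 0 1)ᶜ = 0 := by
  apply withDensity_absolutelyContinuous
  rw [Measure.restrict_apply measurableSet_ball.compl]
  simp

theorem rpow_le_mul_rpow_of_comparable {x y : ℝ} (α : ℝ) (hx : 0 < x) (hy : 0 < y)
    (hxy : x ≤ 4 * y) (hyx : y ≤ 4 * x) : x ^ α ≤ 4 ^ |α| * y ^ α := by
  rcases le_total 0 α with h | h
  · rw [abs_of_nonneg h, ← Real.mul_rpow (by norm_num) hy.le]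
    exact Real.rpow_le_rpow hx.le hxy h
  · rw [abs_of_nonpos h, Real.rpow_neg (by norm_num), ← Real.inv_rpow (by norm_num),
      ← Real.mul_rpow (by norm_num) hy.le]
    apply Real.rpow_le_rpow_of_nonpos (by positivity) _ h
    linarith

/-- Sub-mean value property of `‖f‖ ^ p` with respect to the weighted area, on discs of
hyperbolically bounded size. -/
theorem norm_rpow_mul_le_setLIntegral_weightedArea {f : ℂ → ℂ} {p α : ℝ} (hp : 0 < p)
    (hf : DifferentiableOn ℂ f (Metric.ball 0 1)) {z : ℂ} (hz : ‖z‖ < 1) :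
    ENNReal.ofReal (‖f z‖ ^ p * (1 - ‖z‖) ^ (α + 2)) ≤
      ENNReal.ofReal (4 ^ |α| * 2) *
        ∫⁻ w in Metric.ball z ((1 - ‖z‖) / 2), ENNReal.ofReal (‖f w‖ ^ p) ∂weightedArea α := by
  set δ := 1 - ‖z‖ with hδ
  have hδ0 : 0 < δ := by linarith
  have hδ1 : δ ≤ 1 := by linarith [norm_nonneg z]
  have hw : ∀ w ∈ Metric.ball z (δ / 2), ‖w‖ ≤ ‖z‖ + δ / 2 ∧ ‖z‖ ≤ ‖w‖ + δ / 2 := by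
    intro w hw
    rw [mem_ball_iff_norm] at hw
    constructor
    · linarith [norm_sub_norm_le w z]
    · linarith [norm_sub_norm_le z w, norm_sub_rev z w]
  have hsub : Metric.ball z (δ / 2) ⊆ Metric.ball 0 1 := by
    intro w h
    rw [mem_ball_zero_iff]
    linarith [(hw w h).1]
  rw [setLIntegral_weightedArea _ _ measurableSet_ball, Set.inter_eq_left.2 hsub]
  have h1 := norm_rpow_mul_le_setLIntegral (c := z) (ρ := δ / 2) (by positivity) hp (hf.mono hsub)
  calc ENNReal.ofReal (‖f z‖ ^ p * δ ^ (α + 2))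
      ≤ ENNReal.ofReal (δ ^ α * 2) * ENNReal.ofReal (‖f z‖ ^ p * (Real.pi * (δ / 2) ^ 2)) := by
        rw [← ENNReal.ofReal_mul (by positivity)]
        apply ENNReal.ofReal_le_ofReal
        rw [Real.rpow_add hδ0]
        -- The factor 2 in the constant is there because a disc of radius δ/2 has area πδ²/4, and 2
        -- · π/4 ≥ 1.
        have h3 : (1 : ℝ) ≤ Real.pi / 2 := by linarith [Real.pi_gt_three]
        have h4 : 0 ≤ ‖f z‖ ^ p * δ ^ α * δ ^ 2 := by positivity
        have : δ ^ (2 : ℝ) = δ ^ 2 := by norm_cast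
        rw [this]
        nlinarith
    _ ≤ ENNReal.ofReal (δ ^ α * 2) * ∫⁻ w in Metric.ball z (δ / 2), ENNReal.ofReal (‖f w‖ ^ p) := by
        gcongr
    _ = ∫⁻ w in Metric.ball z (δ / 2), ENNReal.ofReal (δ ^ α * 2) * ENNReal.ofReal (‖f w‖ ^ p) := by
        rw [lintegral_const_mul' _ _ ENNReal.ofReal_ne_top]
    _ ≤ ∫⁻ w in Metric.ball z (δ / 2), ENNReal.ofReal (4 ^ |α| * 2) *
          (ENNReal.ofReal ((1 - ‖w‖ ^ 2) ^ α) * ENNReal.ofReal (‖f w‖ ^ p)) := by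
        apply setLIntegral_mono' measurableSet_ball
        intro w h
        obtain ⟨ha, hb⟩ := hw w h
        rw [← mul_assoc, ← ENNReal.ofReal_mul (p := 4 ^ |α| * 2) (by positivity)]
        gcongr ENNReal.ofReal ?_ * _
        have h0 := norm_nonneg w
        have := rpow_le_mul_rpow_of_comparable (x := δ) (y := 1 - ‖w‖ ^ 2) α hδ0 (by nlinarith)
          (by nlinarith) (by nlinarith)
        linarith
    _ = _ := by rw [lintegral_const_mul' _ _ ENNReal.ofReal_ne_top]

/-- Annuli of dyadic width, with bounded overlap. -/
def dyadicAnnulus (j : ℕ) : Set ℂ := {w | (1 / 2 : ℝ) ^ (j + 2) < 1 - ‖w‖ ∧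
  1 - ‖w‖ < 2 * (1 / 2) ^ j}

theorem measurableSet_dyadicAnnulus (j : ℕ) : MeasurableSet (dyadicAnnulus j) :=
  MeasurableSet.inter (s₁ := {w : ℂ | (1 / 2 : ℝ) ^ (j + 2) < 1 - ‖w‖})
    (s₂ := {w : ℂ | 1 - ‖w‖ < 2 * (1 / 2) ^ j}) (measurableSet_lt (by fun_prop) (by fun_prop))
    (measurableSet_lt (by fun_prop) (by fun_prop))

theorem tsum_indicator_dyadicAnnulus_le (w : ℂ) :
    ∑' j, (dyadicAnnulus j).indicator (1 : ℂ → ℝ≥0∞) w ≤ 3 := by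
  rcases le_or_gt (1 - ‖w‖) 0 with h | h
  · have : ∀ j, (dyadicAnnulus j).indicator (1 : ℂ → ℝ≥0∞) w = 0 := by
      intro j
      apply Set.indicator_of_notMem
      rintro ⟨h1, -⟩
      have : 0 < (1 / 2 : ℝ) ^ (j + 2) := by positivity
      linarith
    simp [this]
  · obtain ⟨k, hk1, hk2⟩ := exists_nat_pow_near_of_lt_one h (by linarith [norm_nonneg w])
      (by norm_num : (0 : ℝ) < 1 / 2) (by norm_num)
    -- If 2^(-k-1) < 1 - |w| ≤ 2^(-k), only the annuli k - 1, k, k + 1 can contain w; truncated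
    -- subtraction at k = 0 loses nothing.
    rw [tsum_eq_sum (s := Finset.Icc (k - 1) (k + 1))]
    · calc _ ≤ ∑ j ∈ Finset.Icc (k - 1) (k + 1), (1 : ℝ≥0∞) := by
            gcongr
            exact Set.indicator_le_self' (fun _ _ => zero_le) w
        _ ≤ 3 := by
          rw [Finset.sum_const, Nat.card_Icc, nsmul_eq_mul, mul_one]
          exact_mod_cast (by lia : k + 1 + 1 - (k - 1) ≤ 3)
    · intro j hj
      apply Set.indicator_of_notMem
      rintro ⟨h1, h2⟩
      apply hj
      have h3 : (1 / 2 : ℝ) ^ (j + 2) < (1 / 2) ^ k := h1.trans_le hk2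
      have h4 : (1 / 2 : ℝ) ^ (k + 2) < (1 / 2) ^ j := by
        have := hk1.trans h2
        rw [pow_succ _ (k + 1)]; linarith
      rw [pow_lt_pow_iff_right_of_lt_one₀ (by norm_num) (by norm_num)] at h3 h4
      rw [Finset.mem_Icc]
      lia

/-- The bounded overlap is converted into the inequality of measures Σ ν|_{annulus j} ≤ 3ν, so that
no measurability of F is needed. -/
theorem tsum_setLIntegral_dyadicAnnulus_le (ν : Measure ℂ) (F : ℂ → ℝ≥0∞) :
    ∑' j, ∫⁻ w in dyadicAnnulus j, F w ∂ν ≤ 3 * ∫⁻ w, F w ∂ν := by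
  have h : Measure.sum (fun j => ν.restrict (dyadicAnnulus j)) ≤ (3 : ℝ≥0∞) • ν := by
    rw [Measure.le_iff]
    intro s hs
    rw [Measure.sum_apply _ hs]
    calc ∑' j, ν.restrict (dyadicAnnulus j) s
        = ∑' j, ∫⁻ w in s, (dyadicAnnulus j).indicator (1 : ℂ → ℝ≥0∞) w ∂ν := by
          congr 1; ext j
          rw [lintegral_indicator_one (measurableSet_dyadicAnnulus j),
            Measure.restrict_apply hs, Measure.restrict_apply (measurableSet_dyadicAnnulus j),
            Set.inter_comm]
      _ = ∫⁻ w in s, ∑' j, (dyadicAnnulus j).indicator (1 : ℂ → ℝ≥0∞) w ∂ν := by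
          rw [lintegral_tsum]
          exact fun j => (measurable_one.indicator (measurableSet_dyadicAnnulus j)).aemeasurable
      _ ≤ ∫⁻ w in s, 3 ∂ν := lintegral_mono fun w => tsum_indicator_dyadicAnnulus_le w
      _ = _ := by simp
  calc _ = ∫⁻ w, F w ∂Measure.sum (fun j => ν.restrict (dyadicAnnulus j)) := by
        rw [lintegral_sum_measure]
    _ ≤ ∫⁻ w, F w ∂((3 : ℝ≥0∞) • ν) := lintegral_mono' h le_rfl
    _ = _ := by rw [lintegral_smul_measure, smul_eq_mul]

/-- The annuli are wide enough to contain the disc of radius (1 - |z|)/2 about every z with 2^(-j-1)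
< 1 - |z| ≤ 2^(-j), so the local sub-mean value estimate can be read off on annulus j. -/
theorem norm_rpow_mul_le_setLIntegral_dyadicAnnulus {f : ℂ → ℂ} {p α : ℝ} (hp : 0 < p)
    (hα : -2 ≤ α)
    (hf : DifferentiableOn ℂ f (Metric.ball 0 1)) {z : ℂ} {j : ℕ}
    (h1 : (1 / 2 : ℝ) ^ (j + 1) < 1 - ‖z‖) (h2 : 1 - ‖z‖ ≤ (1 / 2) ^ j) :
    ENNReal.ofReal (‖f z‖ ^ p * ((1 / 2 : ℝ) ^ j) ^ (α + 2)) ≤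
      ENNReal.ofReal (2 ^ (α + 2) * (4 ^ |α| * 2)) *
        ∫⁻ w in dyadicAnnulus j, ENNReal.ofReal (‖f w‖ ^ p) ∂weightedArea α := by
  have hj : 0 < (1 / 2 : ℝ) ^ (j + 1) := by positivity
  have hj2 : (1 / 2 : ℝ) ^ j = 2 * (1 / 2 : ℝ) ^ (j + 1) := by rw [pow_succ]; ring
  have hsub : Metric.ball z ((1 - ‖z‖) / 2) ⊆ dyadicAnnulus j := by
    intro w hw
    rw [mem_ball_iff_norm] at hw
    have ha := norm_sub_norm_le w z
    have hb := norm_sub_norm_le z w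
    rw [norm_sub_rev] at hb
    refine ⟨?_, ?_⟩
    · rw [pow_succ _ (j + 1)]; linarith
    · linarith
  rw [ENNReal.ofReal_mul (p := 2 ^ (α + 2)) (by positivity), mul_assoc]
  calc _ ≤ ENNReal.ofReal (2 ^ (α + 2)) * ENNReal.ofReal (‖f z‖ ^ p * (1 - ‖z‖) ^ (α + 2)) := by
        rw [← ENNReal.ofReal_mul (by positivity)]
        apply ENNReal.ofReal_le_ofReal
        calc ‖f z‖ ^ p * ((1 / 2 : ℝ) ^ j) ^ (α + 2)
            ≤ ‖f z‖ ^ p * (2 * (1 - ‖z‖)) ^ (α + 2) := by gcongr <;> linarith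
          _ = _ := by rw [Real.mul_rpow (by norm_num) (by linarith)]; ring
    _ ≤ _ := by
        gcongr
        exact (norm_rpow_mul_le_setLIntegral_weightedArea hp hf (by linarith)).trans
          (by gcongr)

/-! ### Weighted area near the boundary point 1. -/

theorem setLIntegral_one_sub_rpow {α : ℝ} (hα : -1 < α) {δ : ℝ} (hδ : 0 ≤ δ) :
    ∫⁻ r in Set.Ioc (1 - δ) 1, ENNReal.ofReal ((1 - r) ^ α) =
      ENNReal.ofReal (δ ^ (α + 1) / (α + 1)) := by
  have hi : IntervalIntegrable (fun r : ℝ => (1 - r) ^ α) volume (1 - δ) 1 := by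
    have := (intervalIntegral.intervalIntegrable_rpow' (a := δ) (b := 0) hα).comp_sub_left 1
    simpa using this
  rw [← ofReal_integral_eq_lintegral_ofReal hi.1, ← intervalIntegral.integral_of_le (by linarith),
    intervalIntegral.integral_comp_sub_left (fun r : ℝ => r ^ α), integral_rpow (Or.inl hα)]
  · simp [Real.zero_rpow (by linarith : α + 1 ≠ 0)]
  · rw [EventuallyLE, ae_restrict_iff' measurableSet_Ioc]
    filter_upwards with r hr
    exact Real.rpow_nonneg (by linarith [hr.2]) _

/-- For δ ≥ 1/2 the bound is just |θ| ≤ π. For δ < 1/2 one has r ≥ 1/2, so |1 - re^(iθ)|² = (1 - r)²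
+ 2r(1 - cos θ) ≥ 1 - cos θ ≥ 2θ²/π². -/
theorem abs_le_of_norm_one_sub_circleMap_le {r θ δ : ℝ} (hθ : |θ| ≤ Real.pi)
    (h : ‖1 - circleMap 0 r θ‖ ≤ δ) (hr : 1 - δ ≤ r) : |θ| ≤ 2 * Real.pi * δ := by
  have hδ : 0 ≤ δ := (norm_nonneg _).trans h
  rcases le_or_gt (1 / 2) δ with h' | h'
  · nlinarith [Real.pi_pos]
  · have h1 : ‖1 - circleMap 0 r θ‖ ^ 2 ≤ δ ^ 2 := by gcongr
    have h2 : ‖1 - circleMap 0 r θ‖ ^ 2 = (1 - r) ^ 2 + 2 * r * (1 - Real.cos θ) := by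
      rw [← Complex.normSq_eq_norm_sq, Complex.normSq_apply]
      simp [circleMap, Complex.exp_ofReal_mul_I_re, Complex.exp_ofReal_mul_I_im]
      nlinarith [Real.sin_sq_add_cos_sq θ]
    have h3 := Real.cos_le_one_sub_mul_cos_sq hθ
    have h4 : 2 / Real.pi ^ 2 * θ ^ 2 ≤ δ ^ 2 := by
      nlinarith [Real.cos_le_one θ, sq_nonneg (1 - r)]
    rw [div_mul_eq_mul_div, div_le_iff₀ (by positivity)] at h4
    apply abs_le_of_sq_le_sq _ (by positivity)
    nlinarith [sq_nonneg (Real.pi * δ)]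

/-- The weighted area of a boundary neighbourhood of `1` of radius `δ` is `O(δ ^ (α + 2))`. -/
theorem weightedArea_closedBall_one_le {α : ℝ} (hα : -1 < α) {δ : ℝ} (hδ : 0 ≤ δ) :
    weightedArea α (Metric.closedBall 1 δ) ≤
      ENNReal.ofReal (2 ^ |α| * (4 * Real.pi) / (α + 1) * δ ^ (α + 2)) := by
  have hm : MeasurableSet (Metric.closedBall (1 : ℂ) δ ∩ Metric.ball 0 1) :=
    measurableSet_closedBall.inter measurableSet_ball
  have hF : Measurable ((Metric.closedBall (1 : ℂ) δ ∩ Metric.ball 0 1).indicator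
      fun z => ENNReal.ofReal ((1 - ‖z‖ ^ 2) ^ α)) :=
    Measurable.indicator (by fun_prop) hm
  rw [← setLIntegral_one, setLIntegral_weightedArea _ _ measurableSet_closedBall]
  simp only [mul_one]
  rw [← lintegral_indicator hm, lintegral_eq_lintegral_circleMap hF 0]
  -- On the circle of radius r the set is empty unless 1 - δ ≤ r < 1, and then it lies in an arc of
  -- angular length at most 4πδ. The remaining radial integral of (1 - r)^α supplies δ^(α+1).
  have key : ∀ r ∈ Set.Ioi (0 : ℝ), ENNReal.ofReal r *
      ∫⁻ θ in Set.Ioo (-Real.pi) Real.pi, ((Metric.closedBall (1 : ℂ) δ ∩ Metric.ball 0 1).indicator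
        fun z => ENNReal.ofReal ((1 - ‖z‖ ^ 2) ^ α)) (circleMap 0 r θ) ≤
      (Set.Icc (1 - δ) 1).indicator (fun r => ENNReal.ofReal (2 ^ |α| * (4 * Real.pi * δ)) *
        ENNReal.ofReal ((1 - r) ^ α)) r := by
    intro r hr
    rw [Set.mem_Ioi] at hr
    have hnorm : ∀ θ, ‖circleMap 0 r θ‖ = r := fun θ => by simp [abs_of_pos hr]
    by_cases hr' : r ∈ Set.Icc (1 - δ) 1
    · rw [Set.indicator_of_mem hr']
      have h1 : ∀ θ ∈ Set.Ioo (-Real.pi) Real.pi,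
          ((Metric.closedBall (1 : ℂ) δ ∩ Metric.ball 0 1).indicator
          fun z => ENNReal.ofReal ((1 - ‖z‖ ^ 2) ^ α)) (circleMap 0 r θ) ≤
          (Set.Icc (-(2 * Real.pi * δ)) (2 * Real.pi * δ)).indicator
            (fun _ => ENNReal.ofReal (2 ^ |α|) * ENNReal.ofReal ((1 - r) ^ α)) θ := by
        intro θ hθ
        by_cases h : circleMap 0 r θ ∈ Metric.closedBall (1 : ℂ) δ ∩ Metric.ball 0 1
        · have hd : |θ| ≤ 2 * Real.pi * δ := by
            apply abs_le_of_norm_one_sub_circleMap_le (abs_le.2 ⟨hθ.1.le, hθ.2.le⟩) _ hr'.1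
            rw [← mem_closedBall_iff_norm']; exact h.1
          have hr1 : r < 1 := by have := h.2; rwa [mem_ball_zero_iff, hnorm] at this
          rw [Set.indicator_of_mem h, Set.indicator_of_mem (Set.mem_Icc.2 (abs_le.1 hd)), hnorm,
            ← ENNReal.ofReal_mul (by positivity)]
          apply ENNReal.ofReal_le_ofReal
          have : 1 - r ^ 2 = (1 + r) * (1 - r) := by ring
          rw [this, Real.mul_rpow (by linarith) (by linarith)]
          gcongr
          calc (1 + r) ^ α ≤ (1 + r) ^ |α| :=
                Real.rpow_le_rpow_of_exponent_le (by linarith) (le_abs_self α)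
            _ ≤ 2 ^ |α| := by gcongr; linarith
        · rw [Set.indicator_of_notMem h]; exact zero_le
      calc _ ≤ 1 * ∫⁻ θ in Set.Ioo (-Real.pi) Real.pi,
            (Set.Icc (-(2 * Real.pi * δ)) (2 * Real.pi * δ)).indicator
            (fun _ => ENNReal.ofReal (2 ^ |α|) * ENNReal.ofReal ((1 - r) ^ α)) θ := by
            gcongr ?_ * ?_
            · exact ENNReal.ofReal_le_one.2 hr'.2
            · exact setLIntegral_mono' measurableSet_Ioo h1
        _ ≤ ∫⁻ θ, (Set.Icc (-(2 * Real.pi * δ)) (2 * Real.pi * δ)).indicator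
            (fun _ => ENNReal.ofReal (2 ^ |α|) * ENNReal.ofReal ((1 - r) ^ α)) θ := by
            rw [one_mul]; exact setLIntegral_le_lintegral _ _
        _ = _ := by
            rw [lintegral_indicator_const measurableSet_Icc, Real.volume_Icc,
              ENNReal.ofReal_mul (by positivity)]
            have : 2 * Real.pi * δ - -(2 * Real.pi * δ) = 4 * Real.pi * δ := by ring
            rw [this]; ring
    · rw [Set.indicator_of_notMem hr']
      have : ∀ θ, ((Metric.closedBall (1 : ℂ) δ ∩ Metric.ball 0 1).indicator
        fun z => ENNReal.ofReal ((1 - ‖z‖ ^ 2) ^ α)) (circleMap 0 r θ) = 0 := by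
        intro θ
        apply Set.indicator_of_notMem
        rintro ⟨h1, h2⟩
        rw [mem_ball_zero_iff, hnorm] at h2
        rw [mem_closedBall_iff_norm'] at h1
        apply hr'
        have := norm_sub_norm_le 1 (circleMap 0 r θ)
        rw [hnorm, norm_one] at this
        exact ⟨by linarith, h2.le⟩
      simp [this]
  calc _ ≤ ∫⁻ r in Set.Ioi (0 : ℝ), (Set.Icc (1 - δ) 1).indicator
        (fun r => ENNReal.ofReal (2 ^ |α| * (4 * Real.pi * δ)) * ENNReal.ofReal ((1 - r) ^ α)) r :=
        setLIntegral_mono' measurableSet_Ioi key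
    _ ≤ ∫⁻ r, (Set.Icc (1 - δ) 1).indicator
        (fun r => ENNReal.ofReal (2 ^ |α| * (4 * Real.pi * δ)) * ENNReal.ofReal ((1 - r) ^ α)) r :=
        setLIntegral_le_lintegral _ _
    _ = _ := by
        rw [lintegral_indicator measurableSet_Icc, lintegral_const_mul' _ _ ENNReal.ofReal_ne_top,
          ← restrict_Ioc_eq_restrict_Icc, setLIntegral_one_sub_rpow hα hδ,
          ← ENNReal.ofReal_mul (by positivity)]
        congr 1
        rcases hδ.eq_or_lt with rfl | hδ'
        · simp [Real.zero_rpow (by linarith : α + 2 ≠ 0)]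
        · rw [show α + 2 = 1 + (α + 1) by ring, Real.rpow_add hδ' 1, Real.rpow_one]
          field_simp

/-! ### Taylor coefficients and the absolute majorant of a power series. -/

theorem hasSum_taylorCoeffZero {f : ℂ → ℂ} {R : ℝ} (hf : DifferentiableOn ℂ f (Metric.ball 0 R))
    {z : ℂ} (hz : ‖z‖ < R) : HasSum (fun k => taylorCoeffZero f k * z ^ k) (f z) := by
  have h := Complex.hasSum_taylorSeries_on_ball hf (z := z) (by simpa using hz)
  refine h.congr_fun fun k => ?_
  simp only [taylorCoeffZero, sub_zero, smul_eq_mul]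
  ring

/-- Cauchy's estimate in terms of the mean of `‖f‖` over a circle. -/
theorem norm_taylorCoeffZero_mul_le {f : ℂ → ℂ} (hf : DifferentiableOn ℂ f (Metric.ball 0 1))
    {r : ℝ} (hr0 : 0 < r) (hr1 : r < 1) (k : ℕ) :
    ‖taylorCoeffZero f k‖ * r ^ k ≤ Real.circleAverage (fun z => ‖f z‖) 0 r := by
  lift r to ℝ≥0 using hr0.le
  have h1 : HasFPowerSeriesOnBall f (cauchyPowerSeries f 0 r) 0 r :=
    (hf.mono (Metric.closedBall_subset_ball hr1)).hasFPowerSeriesOnBall (by exact_mod_cast hr0)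
  have h2 := h1.hasFPowerSeriesAt.analyticAt.hasFPowerSeriesAt
  have h3 := h1.hasFPowerSeriesAt.eq_formalMultilinearSeries h2
  have h4 := norm_cauchyPowerSeries_le f 0 r k
  rw [h3, FormalMultilinearSeries.ofScalars_norm] at h4
  change ‖taylorCoeffZero f k‖ ≤ _ at h4
  rw [abs_of_pos hr0, inv_pow, ← div_eq_mul_inv, le_div_iff₀ (by positivity)] at h4
  simpa [Real.circleAverage] using h4

/-- The majorant `∑ |a_k| t^k` of a power series. -/
noncomputable def coeffMajorant (f : ℂ → ℂ) (t : ℝ) : ℝ≥0∞ :=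
  ∑' k, ENNReal.ofReal (‖taylorCoeffZero f k‖ * t ^ k)

theorem measurable_coeffMajorant (f : ℂ → ℂ) : Measurable (coeffMajorant f) := by
  unfold coeffMajorant
  fun_prop

/-- Cauchy's estimate on the circle of radius r leaves a geometric series in t/r, whose sum 1/(1 -
t/r) is at most 1/(r - t) because r < 1. -/
theorem coeffMajorant_le {f : ℂ → ℂ} (hf : DifferentiableOn ℂ f (Metric.ball 0 1))
    {t r : ℝ} (ht : 0 ≤ t) (htr : t < r) (hr1 : r < 1) :
    coeffMajorant f t ≤ ENNReal.ofReal (Real.circleAverage (fun z => ‖f z‖) 0 r / (r - t)) := by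
  set M := Real.circleAverage (fun z => ‖f z‖) 0 r
  have hr0 : 0 < r := ht.trans_lt htr
  have hM : 0 ≤ M := Real.circleAverage_nonneg_of_nonneg fun _ _ => norm_nonneg _
  have hq0 : 0 ≤ t / r := by positivity
  have hq1 : t / r < 1 := (div_lt_one hr0).2 htr
  have hs := (hasSum_geometric_of_lt_one hq0 hq1).mul_left M
  calc coeffMajorant f t ≤ ∑' k : ℕ, ENNReal.ofReal (M * (t / r) ^ k) := by
        refine ENNReal.tsum_le_tsum fun k => ENNReal.ofReal_le_ofReal ?_
        rw [div_pow, mul_div_assoc', le_div_iff₀ (by positivity)]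
        have := norm_taylorCoeffZero_mul_le hf hr0 hr1 k
        nlinarith [pow_nonneg ht k]
    _ = ENNReal.ofReal (M * (1 - t / r)⁻¹) := by
        rw [← ENNReal.ofReal_tsum_of_nonneg (fun k => by positivity) hs.summable, hs.tsum_eq]
    _ ≤ _ := by
        apply ENNReal.ofReal_le_ofReal
        rw [div_eq_mul_inv M]
        refine mul_le_mul_of_nonneg_left (inv_anti₀ (by linarith) ?_) hM
        · rw [le_sub_iff_add_le, ← sub_nonneg]
          have : 1 - (r - t + t / r) = (1 - r) * (r - t) / r := by field_simp; ring
          rw [this]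
          exact div_nonneg (mul_nonneg (by linarith) (by linarith)) hr0.le

/-- With x = 2^(-j-1), the bound `coeffMajorant_le` is integrated over radii in (1 - x/2, 1 - x/4).
One factor x comes from r - t ≥ x/2 and the other from the width of this ring, which lies inside
annulus j + 1. -/
theorem coeffMajorant_mul_le_setLIntegral {f : ℂ → ℂ}
    (hf : DifferentiableOn ℂ f (Metric.ball 0 1)) {t : ℝ} (ht : 0 ≤ t) {j : ℕ}
    (h1 : (1 / 2 : ℝ) ^ (j + 1) < 1 - t) :
    coeffMajorant f t * ENNReal.ofReal (((1 / 2 : ℝ) ^ (j + 1)) ^ 2) ≤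
      3 * ∫⁻ w in dyadicAnnulus (j + 1), ENNReal.ofReal ‖f w‖ := by
  set x : ℝ := (1 / 2 : ℝ) ^ (j + 1) with hx
  have hx0 : 0 < x := by positivity
  have hx1 : x ≤ 1 / 2 := by
    rw [hx, pow_succ]
    have : (1 / 2 : ℝ) ^ j ≤ 1 := pow_le_one₀ (by norm_num) (by norm_num)
    linarith
  have hfin : coeffMajorant f t ≠ ∞ :=
    ((coeffMajorant_le hf ht (r := 1 - x / 2) (by linarith) (by linarith)).trans_lt
      ENNReal.ofReal_lt_top).ne
  obtain ⟨S, hS0, hS⟩ : ∃ S : ℝ, 0 ≤ S ∧ coeffMajorant f t = ENNReal.ofReal S :=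
    ⟨_, ENNReal.toReal_nonneg, (ENNReal.ofReal_toReal hfin).symm⟩
  have hsub : {z : ℂ | ‖z - 0‖ ∈ Set.Ioo (1 - x / 2) (1 - x / 4)} ⊆ dyadicAnnulus (j + 1) := by
    intro z hz
    rw [Set.mem_ofPred_eq, sub_zero] at hz
    refine ⟨?_, ?_⟩
    · rw [pow_succ _ (j + 1 + 1), pow_succ _ (j + 1), ← hx]; linarith [hz.2]
    · rw [← hx]; linarith [hz.1]
  have key := le_setLIntegral_annulus (φ := fun z => ‖f z‖) (c := 0) (a := 1 - x / 2)
    (b := 1 - x / 4) (m := S * (x / 2)) (by linarith) (by linarith) (by positivity)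
    (hf.continuousOn.norm.mono ?_) (fun z => norm_nonneg _) ?_
  · rw [hS, ← ENNReal.ofReal_mul hS0]
    calc ENNReal.ofReal (S * x ^ 2) ≤
        3 * ENNReal.ofReal (S * (x / 2) * (Real.pi * ((1 - x / 4) ^ 2 - (1 - x / 2) ^ 2))) := by
          rw [← ENNReal.ofReal_ofNat 3, ← ENNReal.ofReal_mul (by norm_num)]
          apply ENNReal.ofReal_le_ofReal
          have h3 : (1 - x / 4) ^ 2 - (1 - x / 2) ^ 2 = x / 2 - 3 * x ^ 2 / 16 := by ring
          have h4 : 3 / 8 * x ≤ (1 - x / 4) ^ 2 - (1 - x / 2) ^ 2 := by rw [h3]; nlinarith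
          have h5 : 3 * (3 / 8 * x) ≤ Real.pi * ((1 - x / 4) ^ 2 - (1 - x / 2) ^ 2) := by
            apply mul_le_mul Real.pi_gt_three.le h4 (by positivity) (by positivity)
          have h6 : S * (x / 2) * (3 * (3 / 8 * x)) ≤
              S * (x / 2) * (Real.pi * ((1 - x / 4) ^ 2 - (1 - x / 2) ^ 2)) := by gcongr
          nlinarith [mul_nonneg hS0 (sq_nonneg x)]
      _ ≤ _ := by
          gcongr
          exact key.trans (lintegral_mono_set hsub)
  · intro z hz
    rw [Set.mem_ofPred_eq, sub_zero] at hz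
    rw [mem_ball_zero_iff]; linarith [hz.2]
  · intro r hr
    have hM : 0 ≤ Real.circleAverage (fun z => ‖f z‖) 0 r :=
      Real.circleAverage_nonneg_of_nonneg fun _ _ => norm_nonneg _
    have hrt : x / 2 ≤ r - t := by linarith [hr.1]
    have h := coeffMajorant_le hf ht (r := r) (by linarith) (by linarith [hr.2])
    rw [hS, ENNReal.ofReal_le_ofReal_iff (div_nonneg hM (by linarith)),
      le_div_iff₀ (by linarith)] at h
    nlinarith

theorem rpow_mul_setLIntegral_dyadicAnnulus_le (σ : ℝ) (j : ℕ) (F : ℂ → ℝ≥0∞) :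
    ENNReal.ofReal (((1 / 2 : ℝ) ^ j) ^ σ) * ∫⁻ w in dyadicAnnulus j, F w ≤
      ENNReal.ofReal (4 ^ |σ|) * ∫⁻ w in dyadicAnnulus j, F w ∂weightedArea σ := by
  have hj : 0 < (1 / 2 : ℝ) ^ j := by positivity
  have hj2 : (1 / 2 : ℝ) ^ (j + 2) = (1 / 2) ^ j / 4 := by rw [pow_add]; ring
  have hsub : dyadicAnnulus j ⊆ Metric.ball 0 1 := by
    intro w hw
    have := hw.1
    rw [hj2] at this
    rw [mem_ball_zero_iff]; linarith
  rw [setLIntegral_weightedArea _ _ (measurableSet_dyadicAnnulus j), Set.inter_eq_left.2 hsub,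
    ← lintegral_const_mul' _ _ ENNReal.ofReal_ne_top,
    ← lintegral_const_mul' _ _ ENNReal.ofReal_ne_top]
  apply setLIntegral_mono' (measurableSet_dyadicAnnulus j)
  rintro w hw
  obtain ⟨ha, hb⟩ := hw
  rw [hj2] at ha
  rw [← mul_assoc, ← ENNReal.ofReal_mul (by positivity)]
  gcongr
  have h0 := norm_nonneg w
  have h1 : ‖w‖ < 1 := by linarith
  exact rpow_le_mul_rpow_of_comparable σ hj (by nlinarith) (by nlinarith) (by nlinarith)

/-! ### Embeddings of A^p_α into weighted L¹ spaces. -/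

theorem weightedArea_univ_lt_top {α : ℝ} (hα : -1 < α) : weightedArea α Set.univ < ∞ := by
  calc weightedArea α Set.univ
      ≤ weightedArea α (Metric.closedBall 1 2) + weightedArea α (Metric.ball 0 1)ᶜ := by
        refine le_trans (measure_mono ?_) (measure_union_le _ _)
        intro z _
        by_cases hz : z ∈ Metric.ball (0 : ℂ) 1
        · left
          rw [mem_ball_zero_iff] at hz
          rw [mem_closedBall_iff_norm]
          have := norm_sub_le z 1
          rw [norm_one] at this
          linarith
        · exact Or.inr hz
    _ < ∞ := by
        rw [weightedArea_compl_ball, add_zero]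
        exact (weightedArea_closedBall_one_le hα (by norm_num)).trans_lt ENNReal.ofReal_lt_top

/-- Embedding of weighted Bergman spaces into weighted `L¹` spaces, case `p ≤ 1`. -/
theorem lintegral_norm_lt_top_of_le_one {f : ℂ → ℂ} {p α σ : ℝ} (hα : -2 ≤ α) (hp : 0 < p) (hp1 : p ≤ 1)
    (hf : DifferentiableOn ℂ f (Metric.ball 0 1))
    (hI : ∫⁻ z, ENNReal.ofReal (‖f z‖ ^ p) ∂weightedArea α < ∞)
    (hσ : (α + 2) / p ≤ σ + 2) :
    ∫⁻ z, ENNReal.ofReal ‖f z‖ ∂weightedArea σ < ∞ := by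
  -- The pointwise growth bound of Bergman functions. Writing |f| = |f|^(1-p) |f|^p and applying it
  -- to the first factor costs (1 - |z|²)^(-(α+2)(1-p)/p), and `hσ` says that the remaining weight
  -- is still at most (1 - |z|²)^α.
  obtain ⟨K, hK0, hK⟩ : ∃ K : ℝ, 0 ≤ K ∧ ∀ z ∈ Metric.ball (0 : ℂ) 1,
      ‖f z‖ ^ p * (1 - ‖z‖) ^ (α + 2) ≤ K := by
    have hI' := ENNReal.mul_ne_top (ENNReal.ofReal_ne_top (r := 4 ^ |α| * 2)) hI.ne
    refine ⟨_, ENNReal.toReal_nonneg (a := _), fun z hz => (ENNReal.ofReal_le_iff_le_toReal hI').1 ?_⟩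
    refine (norm_rpow_mul_le_setLIntegral_weightedArea hp hf (by simpa using hz)).trans ?_
    exact mul_le_mul_right (setLIntegral_le_lintegral _ _) _
  rw [lintegral_weightedArea] at hI ⊢
  calc _ ≤ ∫⁻ z in Metric.ball (0 : ℂ) 1, ENNReal.ofReal (K ^ ((1 - p) / p) * 2 ^ ((α + 2) / p * (1 - p))) *
        (ENNReal.ofReal ((1 - ‖z‖ ^ 2) ^ α) * ENNReal.ofReal (‖f z‖ ^ p)) := by
        apply setLIntegral_mono' measurableSet_ball
        intro z hz
        have hKz := hK z hz
        rw [mem_ball_zero_iff] at hz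
        have h0 := norm_nonneg z
        set y := 1 - ‖z‖ ^ 2 with hy
        have hy0 : 0 < y := by nlinarith
        have hy1 : y ≤ 1 := by nlinarith
        have hyz : y / 2 ≤ 1 - ‖z‖ := by nlinarith
        rw [← ENNReal.ofReal_mul (by positivity), ← ENNReal.ofReal_mul (by positivity),
          ← ENNReal.ofReal_mul (by positivity)]
        apply ENNReal.ofReal_le_ofReal
        rcases (norm_nonneg (f z)).eq_or_lt with hfz | hfz
        · rw [← hfz]; simp only [mul_zero]; positivity
        have hb : ‖f z‖ ^ (1 - p) ≤
            K ^ ((1 - p) / p) * 2 ^ ((α + 2) / p * (1 - p)) * y ^ (-((α + 2) / p * (1 - p))) := by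
          have h1 : ‖f z‖ ^ p ≤ K * (y / 2) ^ (-(α + 2)) := by
            rw [Real.rpow_neg (by positivity), ← div_eq_mul_inv, le_div_iff₀ (by positivity)]
            exact le_trans (mul_le_mul_of_nonneg_left
              (Real.rpow_le_rpow (by positivity) hyz (by linarith)) (by positivity)) hKz
          have h2 : ‖f z‖ ^ (1 - p) = (‖f z‖ ^ p) ^ ((1 - p) / p) := by
            rw [← Real.rpow_mul hfz.le]; congr 1; field_simp
          rw [h2]
          calc _ ≤ (K * (y / 2) ^ (-(α + 2))) ^ ((1 - p) / p) := by
                have : 0 ≤ (1 - p) / p := div_nonneg (by linarith) hp.le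
                gcongr
            _ = _ := by
                rw [Real.mul_rpow hK0 (by positivity), ← Real.rpow_mul (by positivity),
                  Real.div_rpow hy0.le (by norm_num), mul_assoc]
                congr 1
                have : -(α + 2) * ((1 - p) / p) = -((α + 2) / p * (1 - p)) := by field_simp
                rw [this, Real.rpow_neg (by norm_num : (0 : ℝ) ≤ 2)]
                field_simp
        calc y ^ σ * ‖f z‖ = y ^ σ * (‖f z‖ ^ (1 - p) * ‖f z‖ ^ p) := by
              rw [← Real.rpow_add hfz]; simp
          _ ≤ y ^ σ * (K ^ ((1 - p) / p) * 2 ^ ((α + 2) / p * (1 - p)) *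
              y ^ (-((α + 2) / p * (1 - p))) * ‖f z‖ ^ p) := by gcongr
          _ = K ^ ((1 - p) / p) * 2 ^ ((α + 2) / p * (1 - p)) *
              (y ^ (σ - (α + 2) / p * (1 - p)) * ‖f z‖ ^ p) := by
              rw [sub_eq_add_neg σ, Real.rpow_add hy0]; ring
          _ ≤ _ := by
              gcongr _ * (?_ * _)
              apply Real.rpow_le_rpow_of_exponent_ge hy0 hy1
              have : (α + 2) / p * (1 - p) = (α + 2) / p - (α + 2) := by field_simp
              rw [this]; linarith
    _ < ∞ := by
        rw [lintegral_const_mul' _ _ ENNReal.ofReal_ne_top]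
        exact ENNReal.mul_lt_top ENNReal.ofReal_lt_top hI

/-- Embedding of weighted Bergman spaces into weighted `L¹` spaces, case `p ≥ 1`. -/
theorem lintegral_norm_lt_top_of_one_le {f : ℂ → ℂ} {p α σ : ℝ} (hp1 : 1 ≤ p)
    (hI : ∫⁻ z, ENNReal.ofReal (‖f z‖ ^ p) ∂weightedArea α < ∞)
    (hσ : (α + 1) / p - 1 < σ) :
    ∫⁻ z, ENNReal.ofReal ‖f z‖ ∂weightedArea σ < ∞ := by
  have hp : 0 < p := by linarith
  have hfin := weightedArea_univ_lt_top (α := σ - (α + 1) / p) (by linarith)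
  rw [← setLIntegral_one, setLIntegral_weightedArea _ _ MeasurableSet.univ] at hfin
  rw [lintegral_weightedArea] at hI ⊢
  simp only [mul_one, Set.univ_inter] at hfin
  calc _ ≤ ∫⁻ z in Metric.ball (0 : ℂ) 1, (ENNReal.ofReal ((1 - ‖z‖ ^ 2) ^ (σ - (α + 1) / p)) +
        (ENNReal.ofReal ((1 - ‖z‖ ^ 2) ^ α) * ENNReal.ofReal (‖f z‖ ^ p))) := by
        apply setLIntegral_mono' measurableSet_ball
        intro z hz
        rw [mem_ball_zero_iff] at hz
        have h0 := norm_nonneg z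
        set y := 1 - ‖z‖ ^ 2 with hy
        have hy0 : 0 < y := by nlinarith
        have hy1 : y ≤ 1 := by nlinarith
        rw [← ENNReal.ofReal_mul (by positivity), ← ENNReal.ofReal_mul (by positivity),
          ← ENNReal.ofReal_add (by positivity) (by positivity)]
        apply ENNReal.ofReal_le_ofReal
        -- Threshold replacing Hölder's inequality: where |f| ≤ l, the weight y^σ l is integrable
        -- since σ - (α+1)/p > -1; where |f| > l, one has |f| ≤ l^(1-p) |f|^p, and the same
        -- inequality gives y^σ l^(1-p) ≤ y^α.
        set l := y ^ (-((α + 1) / p)) with hl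
        have hl0 : 0 < l := by positivity
        have h1 : ‖f z‖ ≤ l + l ^ (1 - p) * ‖f z‖ ^ p := by
          rcases le_or_gt ‖f z‖ l with h | h
          · have : 0 ≤ l ^ (1 - p) * ‖f z‖ ^ p := by positivity
            linarith
          · have hfz : 0 < ‖f z‖ := hl0.trans h
            calc ‖f z‖ = ‖f z‖ ^ (1 - p) * ‖f z‖ ^ p := by rw [← Real.rpow_add hfz]; simp
              _ ≤ l ^ (1 - p) * ‖f z‖ ^ p := by
                  gcongr ?_ * _
                  exact Real.rpow_le_rpow_of_nonpos hl0 h.le (by linarith)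
              _ ≤ _ := by linarith
        calc y ^ σ * ‖f z‖ ≤ y ^ σ * (l + l ^ (1 - p) * ‖f z‖ ^ p) := by gcongr
          _ = y ^ (σ - (α + 1) / p) + y ^ (σ + -((α + 1) / p) * (1 - p)) * ‖f z‖ ^ p := by
              rw [sub_eq_add_neg σ, Real.rpow_add hy0, Real.rpow_add hy0, Real.rpow_mul hy0.le]
              ring
          _ ≤ _ := by
              gcongr _ + ?_ * _
              apply Real.rpow_le_rpow_of_exponent_ge hy0 hy1
              have : -((α + 1) / p) * (1 - p) = (α + 1) - (α + 1) / p := by field_simp; ring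
              rw [this]; linarith
    _ < ∞ := by
        rw [lintegral_add_left (by fun_prop)]
        exact ENNReal.add_lt_top.2 ⟨hfin, hI⟩

/-! ### The binomial kernel and the integral form of the operator. -/

theorem Ring.multichoose_eq_Gamma_div {β : ℝ} (hβ : 0 < β) (n : ℕ) :
    Ring.multichoose β n = Real.Gamma (n + β) / (n.factorial * Real.Gamma β) := by
  have h : ∀ n : ℕ, (ascPochhammer ℕ n).smeval β = Real.Gamma (n + β) / Real.Gamma β := by
    intro n
    induction n with
    | zero => simp [(Real.Gamma_pos_of_pos hβ).ne']
    | succ n ih =>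
      rw [ascPochhammer_succ_right, Polynomial.smeval_mul, ih, Polynomial.smeval_add,
        Polynomial.smeval_X, Polynomial.smeval_natCast, pow_one, pow_zero, nsmul_eq_mul, mul_one,
        Nat.cast_add_one, show (n : ℝ) + 1 + β = n + β + 1 by ring,
        Real.Gamma_add_one (by positivity)]
      ring
  have h2 := Ring.factorial_nsmul_multichoose_eq_ascPochhammer β n
  rw [h, nsmul_eq_mul] at h2
  rw [mul_comm, ← div_div, ← h2]
  field_simp

theorem hasSum_Gamma_div_mul_pow {β : ℝ} (hβ : 0 < β) {w : ℂ} (hw : ‖w‖ < 1) :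
    HasSum (fun n : ℕ => ((Real.Gamma (n + β) / (n.factorial * Real.Gamma β) : ℝ) : ℂ) * w ^ n)
      (1 / (1 - w) ^ (β : ℂ)) := by
  have h := (Complex.one_div_one_sub_cpow_hasFPowerSeriesOnBall_zero β).hasSum (y := w)
    (by simpa [enorm_eq_nnnorm, ← NNReal.coe_lt_coe] using hw)
  rw [zero_add] at h
  refine h.congr_fun fun n => ?_
  rw [FormalMultilinearSeries.ofScalars_apply_eq, smul_eq_mul, ← Ring.multichoose_eq_Gamma_div hβ,
    Ring.multichoose_eq, Complex.ofReal_choose]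
  push_cast
  rfl

theorem Gamma_div_nonneg {β : ℝ} (hβ : 0 < β) (n : ℕ) :
    0 ≤ Real.Gamma (n + β) / (n.factorial * Real.Gamma β) := by
  have := Real.Gamma_pos_of_pos hβ
  have := Real.Gamma_pos_of_pos (show (0 : ℝ) < n + β by positivity)
  positivity

/-- The integral form of the generalized Hilbert operator. -/
noncomputable def hilbertIntegral (μ : Measure (Set.Ico (0 : ℝ) 1)) (β : ℝ) (f : ℂ → ℂ) (z : ℂ) :
    ℂ :=
  ∫ t, f (t : ℝ) * (1 / (1 - (t : ℝ) * z) ^ (β : ℂ)) ∂μ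

section

variable {μ : Measure (Set.Ico (0 : ℝ) 1)} {f : ℂ → ℂ} {β : ℝ}

theorem measurable_comp_Ico (hf : DifferentiableOn ℂ f (Metric.ball 0 1)) :
    Measurable fun t : Set.Ico (0 : ℝ) 1 => f (t : ℝ) := by
  apply Continuous.measurable
  apply hf.continuousOn.comp_continuous (by fun_prop)
  intro t
  rw [mem_ball_zero_iff, Complex.norm_real, Real.norm_of_nonneg t.2.1]
  exact t.2.2

theorem enorm_le_coeffMajorant (hf : DifferentiableOn ℂ f (Metric.ball 0 1))
    (t : Set.Ico (0 : ℝ) 1) : ‖f (t : ℝ)‖ₑ ≤ coeffMajorant f t := by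
  have h := hasSum_taylorCoeffZero hf (z := (t : ℝ))
    (by rw [Complex.norm_real, Real.norm_of_nonneg t.2.1]; exact t.2.2)
  rw [← h.tsum_eq]
  refine (enorm_tsum_le_tsum_enorm).trans (ENNReal.tsum_le_tsum fun k => ?_)
  rw [← ofReal_norm, norm_mul, norm_pow, Complex.norm_real, Real.norm_of_nonneg t.2.1]

theorem integrable_comp_of_lintegral_coeffMajorant
    (hf : DifferentiableOn ℂ f (Metric.ball 0 1)) (hA : ∫⁻ t, coeffMajorant f (t : ℝ) ∂μ < ∞) :
    Integrable (fun t : Set.Ico (0 : ℝ) 1 => f (t : ℝ)) μ :=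
  ⟨(measurable_comp_Ico hf).aestronglyMeasurable,
    (lintegral_mono fun t => enorm_le_coeffMajorant hf t).trans_lt hA⟩

/-- Dominated convergence in k: since t^n ≤ 1, the terms are bounded by a constant times |a_k| t^k,
whose sum is integrable against μ by `hA`. -/
theorem hasSum_hankelEntry_mul_taylorCoeffZero (hβ : 0 < β)
    (hf : DifferentiableOn ℂ f (Metric.ball 0 1)) (hA : ∫⁻ t, coeffMajorant f (t : ℝ) ∂μ < ∞)
    (n : ℕ) :
    HasSum (fun k => (hankelEntry μ β n k : ℂ) * taylorCoeffZero f k)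
      (∫ t, ((Real.Gamma (n + β) / (n.factorial * Real.Gamma β) : ℝ) : ℂ) * (t : ℝ) ^ n *
        f (t : ℝ) ∂μ) := by
  set c := Real.Gamma (n + β) / (n.factorial * Real.Gamma β) with hc
  have hc0 : 0 ≤ c := Gamma_div_nonneg hβ n
  have hmeas : Measurable fun t : Set.Ico (0 : ℝ) 1 => coeffMajorant f (t : ℝ) :=
    (measurable_coeffMajorant f).comp measurable_subtype_coe
  have hsum : ∀ᵐ t : Set.Ico (0 : ℝ) 1 ∂μ,
      HasSum (fun k => ‖taylorCoeffZero f k‖ * (t : ℝ) ^ k) (coeffMajorant f (t : ℝ)).toReal := by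
    filter_upwards [ae_lt_top hmeas hA.ne] with t ht
    have hnn : ∀ k, 0 ≤ ‖taylorCoeffZero f k‖ * (t : ℝ) ^ k := fun k =>
      mul_nonneg (norm_nonneg _) (pow_nonneg t.2.1 _)
    have h1 := ENNReal.hasSum_toReal ht.ne
    rw [← ENNReal.tsum_toReal_eq fun _ => ENNReal.ofReal_ne_top] at h1
    refine h1.congr_fun fun k => (ENNReal.toReal_ofReal (hnn k)).symm
  have key := hasSum_integral_of_dominated_convergence (μ := μ)
    (F := fun k (t : Set.Ico (0 : ℝ) 1) =>
      ((c * (t : ℝ) ^ (n + k) : ℝ) : ℂ) * taylorCoeffZero f k)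
    (f := fun t => (c : ℂ) * (t : ℝ) ^ n * f (t : ℝ))
    (fun k t => c * (‖taylorCoeffZero f k‖ * (t : ℝ) ^ k))
    (fun k => Measurable.aestronglyMeasurable (by fun_prop)) ?_ ?_ ?_ ?_
  · refine key.congr_fun fun k => ?_
    have h1 : (∫ t : Set.Ico (0 : ℝ) 1, ((c * (t : ℝ) ^ (n + k) : ℝ) : ℂ) ∂μ) =
        (hankelEntry μ β n k : ℂ) := integral_ofReal
    rw [integral_mul_const, h1]
  · intro k
    filter_upwards with t
    have ht0 : (0 : ℝ) ≤ t := t.2.1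
    rw [norm_mul, Complex.norm_real, Real.norm_of_nonneg (by positivity), pow_add]
    have h1 : (t : ℝ) ^ n ≤ 1 := pow_le_one₀ ht0 t.2.2.le
    calc c * ((t : ℝ) ^ n * (t : ℝ) ^ k) * ‖taylorCoeffZero f k‖
        = (t : ℝ) ^ n * (c * (‖taylorCoeffZero f k‖ * (t : ℝ) ^ k)) := by ring
      _ ≤ 1 * (c * (‖taylorCoeffZero f k‖ * (t : ℝ) ^ k)) := by gcongr
      _ = _ := one_mul _
  · filter_upwards [hsum] with t ht
    exact ht.summable.mul_left c
  · have h1 : Integrable (fun t : Set.Ico (0 : ℝ) 1 => c * (coeffMajorant f (t : ℝ)).toReal) μ :=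
      (integrable_toReal_of_lintegral_ne_top hmeas.aemeasurable hA.ne).const_mul c
    refine h1.congr ?_
    filter_upwards [hsum] with t ht
    exact ((ht.mul_left c).tsum_eq).symm
  · filter_upwards with t
    have h := (hasSum_taylorCoeffZero hf (z := (t : ℝ))
      (by rw [Complex.norm_real, Real.norm_of_nonneg t.2.1]; exact t.2.2)).mul_left
        ((c : ℂ) * (t : ℝ) ^ n)
    refine h.congr_fun fun k => ?_
    push_cast
    ring

/-- Dominated convergence in n: the n-th term is at most c_n |z|^n |f(t)|, with c_n the binomial
coefficients, and Σ c_n |z|^n is finite and independent of t. -/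
theorem hasSum_hilbertIntegral (hβ : 0 < β)
    (hfi : Integrable (fun t : Set.Ico (0 : ℝ) 1 => f (t : ℝ)) μ) {z : ℂ} (hz : ‖z‖ < 1) :
    HasSum (fun n : ℕ => (∫ t, ((Real.Gamma (n + β) / (n.factorial * Real.Gamma β) : ℝ) : ℂ) *
      (t : ℝ) ^ n * f (t : ℝ) ∂μ) * z ^ n) (hilbertIntegral μ β f z) := by
  set c : ℕ → ℝ := fun n => Real.Gamma (n + β) / (n.factorial * Real.Gamma β) with hc
  have hc0 : ∀ n, 0 ≤ c n := Gamma_div_nonneg hβ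
  have hs : Summable fun n => c n * ‖z‖ ^ n := by
    have h := (hasSum_Gamma_div_mul_pow hβ (w := (‖z‖ : ℂ)) (by simpa using hz)).summable.norm
    refine h.congr fun n => ?_
    rw [norm_mul, norm_pow, Complex.norm_real, Complex.norm_real, Real.norm_of_nonneg (hc0 n),
      norm_norm]
  have key := hasSum_integral_of_dominated_convergence (μ := μ)
    (F := fun n (t : Set.Ico (0 : ℝ) 1) => (c n : ℂ) * (t : ℝ) ^ n * f (t : ℝ) * z ^ n)
    (f := fun t => f (t : ℝ) * (1 / (1 - (t : ℝ) * z) ^ (β : ℂ)))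
    (fun n t => c n * ‖z‖ ^ n * ‖f (t : ℝ)‖) ?_ ?_ ?_ ?_ ?_
  · refine key.congr_fun fun n => ?_
    rw [integral_mul_const]
  · intro n
    refine (AEStronglyMeasurable.mul ?_ hfi.1).mul_const _
    exact Measurable.aestronglyMeasurable (by fun_prop)
  · intro n
    filter_upwards with t
    have ht0 : (0 : ℝ) ≤ t := t.2.1
    simp only [norm_mul, norm_pow, Complex.norm_real, Real.norm_of_nonneg (hc0 n),
      Real.norm_of_nonneg ht0]
    have h1 : (t : ℝ) ^ n ≤ 1 := pow_le_one₀ ht0 t.2.2.le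
    have := hc0 n
    calc c n * (t : ℝ) ^ n * ‖f (t : ℝ)‖ * ‖z‖ ^ n
        = (t : ℝ) ^ n * (c n * ‖z‖ ^ n * ‖f (t : ℝ)‖) := by ring
      _ ≤ 1 * (c n * ‖z‖ ^ n * ‖f (t : ℝ)‖) := by gcongr
      _ = _ := one_mul _
  · filter_upwards with t
    exact hs.mul_right _
  · simp_rw [tsum_mul_right]
    exact hfi.norm.const_mul _
  · filter_upwards with t
    have ht0 : (0 : ℝ) ≤ t := t.2.1
    have htz : ‖((t : ℝ) : ℂ) * z‖ < 1 := by
      rw [norm_mul, Complex.norm_real, Real.norm_of_nonneg ht0]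
      nlinarith [t.2.2, norm_nonneg z]
    refine ((hasSum_Gamma_div_mul_pow hβ htz).mul_left (f (t : ℝ))).congr_fun fun n => ?_
    rw [mul_pow]
    ring

/-- A power series converging on the unit disc has an analytic sum. -/
theorem differentiableOn_of_hasSum {b : ℕ → ℂ} {g : ℂ → ℂ}
    (h : ∀ z ∈ Metric.ball (0 : ℂ) 1, HasSum (fun n => b n * z ^ n) (g z)) :
    DifferentiableOn ℂ g (Metric.ball 0 1) := by
  intro z hz
  rw [mem_ball_zero_iff] at hz
  obtain ⟨r, hzr, hr1⟩ := exists_between hz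
  have hr0 : 0 ≤ r := (norm_nonneg z).trans hzr.le
  have hs : Summable fun n => ‖b n‖ * r ^ n := by
    have := (h (r : ℂ) (by simpa [abs_of_nonneg hr0] using hr1)).summable.norm
    refine this.congr fun n => ?_
    rw [norm_mul, norm_pow, Complex.norm_real, Real.norm_of_nonneg hr0]
  have hd := Complex.differentiableOn_tsum_of_summable_norm (U := Metric.ball 0 r) hs
    (F := fun n z => b n * z ^ n) (fun n => by fun_prop) Metric.isOpen_ball (fun n w hw => by
      rw [norm_mul, norm_pow]
      rw [mem_ball_zero_iff] at hw
      gcongr)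
  have hg : DifferentiableOn ℂ g (Metric.ball 0 r) := hd.congr fun w hw => by
    rw [mem_ball_zero_iff] at hw
    exact (h w (by rw [mem_ball_zero_iff]; linarith)).tsum_eq.symm
  exact (hg.differentiableAt (Metric.isOpen_ball.mem_nhds (by simpa using hzr))).differentiableWithinAt

theorem isHilbertImage_hilbertIntegral [IsFiniteMeasure μ] (hβ : 0 < β)
    (hf : DifferentiableOn ℂ f (Metric.ball 0 1)) (hA : ∫⁻ t, coeffMajorant f (t : ℝ) ∂μ < ∞) :
    IsHilbertImage μ β f (hilbertIntegral μ β f) := by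
  have hsum : ∀ z ∈ Metric.ball (0 : ℂ) 1, HasSum (fun n : ℕ =>
      (∫ t, ((Real.Gamma (n + β) / (n.factorial * Real.Gamma β) : ℝ) : ℂ) *
      (t : ℝ) ^ n * f (t : ℝ) ∂μ) * z ^ n) (hilbertIntegral μ β f z) := fun z hz =>
    hasSum_hilbertIntegral hβ (integrable_comp_of_lintegral_coeffMajorant hf hA) (by simpa using hz)
  refine ⟨fun m => ?_, differentiableOn_of_hasSum hsum, _, fun n =>
    (hasSum_hankelEntry_mul_taylorCoeffZero hβ hf hA n).tendsto_sum_nat, hsum⟩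
  refine Integrable.of_bound (C := 1) (Measurable.aestronglyMeasurable (by fun_prop)) ?_
  filter_upwards with t
  rw [norm_pow, Real.norm_of_nonneg t.2.1]
  exact pow_le_one₀ t.2.1 t.2.2.le

/-- Limits of the inner partial sums are unique, so any image, in particular the one supplied by
boundedness, is the integral and can be estimated from below. -/
theorem IsHilbertImage.eq_hilbertIntegral {g : ℂ → ℂ} (h : IsHilbertImage μ β f g) (hβ : 0 < β)
    (hf : DifferentiableOn ℂ f (Metric.ball 0 1)) (hA : ∫⁻ t, coeffMajorant f (t : ℝ) ∂μ < ∞)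
    {z : ℂ} (hz : z ∈ Metric.ball (0 : ℂ) 1) : g z = hilbertIntegral μ β f z := by
  obtain ⟨b, hb, hg⟩ := h.exists_coeff
  have hbn : ∀ n, b n = _ := fun n =>
    tendsto_nhds_unique (hb n) (hasSum_hankelEntry_mul_taylorCoeffZero hβ hf hA n).tendsto_sum_nat
  have h1 := hg z hz
  simp_rw [hbn] at h1
  exact h1.unique (hasSum_hilbertIntegral hβ (integrable_comp_of_lintegral_coeffMajorant hf hA)
    (by simpa using hz))

end

/-! ### Dyadic decompositions of [0,1) and of the disc around 1. -/

theorem half_pow_pos (j : ℕ) : 0 < (1 / 2 : ℝ) ^ j := by positivity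

/-- The dyadic subintervals of `[0, 1)` accumulating at `1`. -/
def dyadicInterval (j : ℕ) : Set (Set.Ico (0 : ℝ) 1) :=
  {t | (1 / 2 : ℝ) ^ (j + 1) < 1 - (t : ℝ) ∧ 1 - (t : ℝ) ≤ (1 / 2) ^ j}

theorem measurableSet_dyadicInterval (j : ℕ) : MeasurableSet (dyadicInterval j) :=
  MeasurableSet.inter (s₁ := {t : Set.Ico (0 : ℝ) 1 | (1 / 2 : ℝ) ^ (j + 1) < 1 - (t : ℝ)})
    (s₂ := {t : Set.Ico (0 : ℝ) 1 | 1 - (t : ℝ) ≤ (1 / 2) ^ j})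
    (measurableSet_lt (by fun_prop) (by fun_prop)) (measurableSet_le (by fun_prop) (by fun_prop))

theorem exists_mem_dyadicInterval (t : Set.Ico (0 : ℝ) 1) : ∃ j, t ∈ dyadicInterval j :=
  exists_nat_pow_near_of_lt_one (by linarith [t.2.2]) (by linarith [t.2.1]) (by norm_num)
    (by norm_num)

/-- The point `1 - 2⁻ʲ`. -/
noncomputable def dyadicPoint (j : ℕ) : Set.Ico (0 : ℝ) 1 :=
  ⟨1 - (1 / 2) ^ j, by
    have : (1 / 2 : ℝ) ^ j ≤ 1 := pow_le_one₀ (by norm_num) (by norm_num)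
    linarith, by linarith [half_pow_pos j]⟩

theorem one_sub_dyadicPoint (j : ℕ) : 1 - (dyadicPoint j : ℝ) = (1 / 2) ^ j := by
  simp [dyadicPoint]

theorem dyadicPoint_mem (j : ℕ) : dyadicPoint j ∈ dyadicInterval j := by
  refine ⟨?_, (one_sub_dyadicPoint j).le⟩
  rw [one_sub_dyadicPoint, pow_succ]
  linarith [half_pow_pos j]

theorem dyadicInterval_subset_Ici (j : ℕ) : dyadicInterval j ⊆ Set.Ici (dyadicPoint j) := by
  intro t ht
  rw [Set.mem_Ici, ← Subtype.coe_le_coe]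
  linarith [ht.2, one_sub_dyadicPoint j]

theorem lintegral_le_tsum_dyadicInterval (μ : Measure (Set.Ico (0 : ℝ) 1))
    (F : Set.Ico (0 : ℝ) 1 → ℝ≥0∞) (b : ℕ → ℝ≥0∞) (h : ∀ j, ∀ t ∈ dyadicInterval j, F t ≤ b j) :
    ∫⁻ t, F t ∂μ ≤ ∑' j, b j * μ (dyadicInterval j) := by
  have hU : (⋃ j, dyadicInterval j) = Set.univ :=
    Set.eq_univ_of_forall fun t => Set.mem_iUnion.2 (exists_mem_dyadicInterval t)
  calc ∫⁻ t, F t ∂μ = ∫⁻ t in ⋃ j, dyadicInterval j, F t ∂μ := by rw [hU, setLIntegral_univ]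
    _ ≤ ∑' j, ∫⁻ t in dyadicInterval j, F t ∂μ := lintegral_iUnion_le _ _
    _ ≤ _ := by
      refine ENNReal.tsum_le_tsum fun j => ?_
      rw [← setLIntegral_const]
      exact setLIntegral_mono' (measurableSet_dyadicInterval j) (h j)

/-- A function on the disc bounded by a sequence on dyadic neighbourhoods of the boundary point `1`
is integrated by the corresponding series. -/
theorem lintegral_weightedArea_le_tsum {α : ℝ} (hα : -1 < α) (F : ℂ → ℝ≥0∞) (b : ℕ → ℝ≥0∞)
    (h : ∀ i, ∀ z ∈ Metric.ball (0 : ℂ) 1, (1 / 2 : ℝ) ^ i < ‖1 - z‖ → F z ≤ b i) :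
    ∫⁻ z, F z ∂weightedArea α ≤
      ENNReal.ofReal (2 ^ |α| * (4 * Real.pi) / (α + 1) * 2 ^ (α + 2)) *
        ∑' i, b i * ENNReal.ofReal (((1 / 2 : ℝ) ^ i) ^ (α + 2)) := by
  set E : ℕ → Set ℂ := fun i => {z | (1 / 2 : ℝ) ^ i < ‖1 - z‖} ∩
    (Metric.closedBall 1 (2 * (1 / 2) ^ i) ∩ Metric.ball 0 1) with hE
  have hEm : ∀ i, MeasurableSet (E i) := fun i =>
    (measurableSet_lt (by fun_prop) (by fun_prop)).inter
      (measurableSet_closedBall.inter measurableSet_ball)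
  have hU : Metric.ball (0 : ℂ) 1 ⊆ ⋃ i, E i := by
    intro z hz
    have hz' := hz
    rw [mem_ball_zero_iff] at hz'
    have h1 := norm_sub_norm_le 1 z
    have h2 := norm_sub_le 1 z
    rw [norm_one] at h1 h2
    -- |1 - z| can be as large as 2, so the dyadic scale is chosen for |1 - z|/2; the shells are
    -- therefore 2^(-i) < |1 - z| ≤ 2 · 2^(-i).
    obtain ⟨i, hi1, hi2⟩ := exists_nat_pow_near_of_lt_one (x := ‖1 - z‖ / 2) (y := (1 / 2 : ℝ))
      (by linarith) (by linarith) (by norm_num) (by norm_num)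
    refine Set.mem_iUnion.2 ⟨i, ?_, ?_, hz⟩
    · change (1 / 2 : ℝ) ^ i < ‖1 - z‖
      rw [pow_succ] at hi1; linarith
    · rw [mem_closedBall_iff_norm']; linarith
  calc ∫⁻ z, F z ∂weightedArea α
      = ∫⁻ z in Metric.ball 0 1, F z ∂weightedArea α := by
        have := weightedArea_compl_ball α
        rw [← setLIntegral_univ]
        apply setLIntegral_congr
        exact (ae_eq_univ.2 this).symm
    _ ≤ ∫⁻ z in ⋃ i, E i, F z ∂weightedArea α := lintegral_mono_set hU
    _ ≤ ∑' i, ∫⁻ z in E i, F z ∂weightedArea α := lintegral_iUnion_le _ _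
    _ ≤ ∑' i, b i * weightedArea α (E i) := by
        refine ENNReal.tsum_le_tsum fun i => ?_
        rw [← setLIntegral_const]
        exact setLIntegral_mono' (hEm i) fun z hz => h i z hz.2.2 hz.1
    _ ≤ ∑' i, ENNReal.ofReal (2 ^ |α| * (4 * Real.pi) / (α + 1) * 2 ^ (α + 2)) *
          (b i * ENNReal.ofReal (((1 / 2 : ℝ) ^ i) ^ (α + 2))) := by
        refine ENNReal.tsum_le_tsum fun i => ?_
        rw [mul_left_comm]
        gcongr
        calc weightedArea α (E i) ≤ weightedArea α (Metric.closedBall 1 (2 * (1 / 2) ^ i)) :=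
              measure_mono fun z hz => hz.2.1
          _ ≤ _ := weightedArea_closedBall_one_le hα (by positivity)
          _ = _ := by
            have : (0 : ℝ) < α + 1 := by linarith
            rw [← ENNReal.ofReal_mul (by positivity), Real.mul_rpow (by norm_num) (by positivity)]
            ring_nf
    _ = _ := ENNReal.tsum_mul_left

/-- Two lower bounds: |1 - tz| ≥ 1 - t, and hence |1 - z| ≤ |1 - tz| + (1 - t) ≤ 2|1 - tz|. -/
theorem half_mul_max_le_norm_one_sub {t : Set.Ico (0 : ℝ) 1} {z : ℂ} {x y : ℝ}
    (hz : ‖z‖ < 1) (ht : y ≤ 2 * (1 - (t : ℝ))) (hxz : x ≤ ‖1 - z‖) :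
    max x y / 2 ≤ ‖1 - (t : ℝ) * z‖ := by
  have ht0 : (0 : ℝ) ≤ t := t.2.1
  have ht1 : (t : ℝ) < 1 := t.2.2
  have h1 : 1 - (t : ℝ) ≤ ‖1 - (t : ℝ) * z‖ := by
    have := norm_sub_norm_le 1 ((t : ℝ) * z)
    rw [norm_one, norm_mul, Complex.norm_real, Real.norm_of_nonneg ht0] at this
    nlinarith
  have h2 : ‖1 - z‖ ≤ ‖1 - (t : ℝ) * z‖ + (1 - t) := by
    have h3 : 1 - z = (1 - (t : ℝ) * z) - ((1 - t : ℝ) : ℂ) * z := by push_cast; ring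
    calc ‖1 - z‖ ≤ ‖1 - (t : ℝ) * z‖ + ‖((1 - t : ℝ) : ℂ) * z‖ := by rw [h3]; exact norm_sub_le _ _
      _ ≤ _ := by
        rw [norm_mul, Complex.norm_real, Real.norm_of_nonneg (by linarith)]
        nlinarith
  rcases max_cases x y with ⟨h, -⟩ | ⟨h, -⟩ <;> rw [h] <;> linarith

/-! ### Discrete inequalities. -/

/-- The kernel is homogeneous of degree 0: for i ≤ j the powers of 2^(-i) cancel and 2^(-(j-i)θ₂)
remains; the other case is symmetric with θ₁. This is the off-diagonal decay behind Schur's test. -/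
theorem half_pow_max_rpow_le {θ₁ θ₂ ε : ℝ} (h1 : ε ≤ θ₁) (h2 : ε ≤ θ₂) (i j : ℕ) :
    ((1 / 2 : ℝ) ^ i) ^ θ₁ * ((1 / 2 : ℝ) ^ j) ^ θ₂ *
      (max ((1 / 2 : ℝ) ^ i) ((1 / 2) ^ j)) ^ (-(θ₁ + θ₂)) ≤
      ((1 / 2 : ℝ) ^ ε) ^ ((i : ℤ) - j).natAbs := by
  have key : ∀ (i j : ℕ) (θ₁ θ₂ : ℝ), ε ≤ θ₂ → i ≤ j →
      ((1 / 2 : ℝ) ^ i) ^ θ₁ * ((1 / 2 : ℝ) ^ j) ^ θ₂ *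
      (max ((1 / 2 : ℝ) ^ i) ((1 / 2) ^ j)) ^ (-(θ₁ + θ₂)) ≤
      ((1 / 2 : ℝ) ^ ε) ^ ((i : ℤ) - j).natAbs := by
    intro i j θ₁ θ₂ h2 hij
    obtain ⟨d, rfl⟩ := Nat.exists_eq_add_of_le hij
    have hi := half_pow_pos i
    have hd := half_pow_pos d
    have hd1 : (1 / 2 : ℝ) ^ d ≤ 1 := pow_le_one₀ (by norm_num) (by norm_num)
    have hm : max ((1 / 2 : ℝ) ^ i) ((1 / 2) ^ (i + d)) = (1 / 2) ^ i := by
      apply max_eq_left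
      rw [pow_add]; nlinarith
    have hn : ((i : ℤ) - (i + d : ℕ)).natAbs = d := by simp
    rw [hm, hn, pow_add, Real.mul_rpow hi.le hd.le]
    have h3 : ((1 / 2 : ℝ) ^ i) ^ θ₁ * (((1 / 2 : ℝ) ^ i) ^ θ₂ * ((1 / 2 : ℝ) ^ d) ^ θ₂) *
        ((1 / 2 : ℝ) ^ i) ^ (-(θ₁ + θ₂)) = ((1 / 2 : ℝ) ^ d) ^ θ₂ := by
      calc _ = (((1 / 2 : ℝ) ^ i) ^ θ₁ * ((1 / 2 : ℝ) ^ i) ^ θ₂ *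
            ((1 / 2 : ℝ) ^ i) ^ (-(θ₁ + θ₂))) * ((1 / 2 : ℝ) ^ d) ^ θ₂ := by ring
        _ = _ := by rw [← Real.rpow_add hi, ← Real.rpow_add hi]; simp
    rw [h3, ← Real.rpow_natCast ((1 / 2 : ℝ) ^ ε), ← Real.rpow_mul (by norm_num), mul_comm ε,
      Real.rpow_mul (by norm_num), Real.rpow_natCast]
    exact Real.rpow_le_rpow_of_exponent_ge hd hd1 h2
  rcases le_total i j with h | h
  · exact key i j θ₁ θ₂ h2 h
  · have := key j i θ₂ θ₁ h1 h
    rw [max_comm, add_comm θ₁, mul_comm (((1 / 2 : ℝ) ^ i) ^ θ₁), ← Int.natAbs_neg, neg_sub]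
    exact this

/-- Two-sided geometric series. -/
noncomputable def twoSidedGeom (r : ℝ) : ℝ≥0∞ := ∑' n : ℤ, ENNReal.ofReal (r ^ n.natAbs)

theorem twoSidedGeom_lt_top {r : ℝ} (h0 : 0 ≤ r) (h1 : r < 1) : twoSidedGeom r < ∞ := by
  have hs : Summable fun n : ℤ => r ^ n.natAbs := by
    apply Summable.of_nat_of_neg <;> simpa using summable_geometric_of_lt_one h0 h1
  rw [twoSidedGeom, ← ENNReal.ofReal_tsum_of_nonneg (fun n => by positivity) hs]
  exact ENNReal.ofReal_lt_top

theorem tsum_pow_natAbs_sub_le (r : ℝ) (j : ℕ) :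
    ∑' i : ℕ, ENNReal.ofReal (r ^ ((i : ℤ) - j).natAbs) ≤ twoSidedGeom r :=
  ENNReal.tsum_comp_le_tsum_of_injective (f := fun i : ℕ => (i : ℤ) - j)
    (fun a b h => by simpa using h) fun n : ℤ => ENNReal.ofReal (r ^ n.natAbs)

theorem tsum_pow_natAbs_sub_le' (r : ℝ) (i : ℕ) :
    ∑' j : ℕ, ENNReal.ofReal (r ^ ((i : ℤ) - j).natAbs) ≤ twoSidedGeom r :=
  ENNReal.tsum_comp_le_tsum_of_injective (f := fun j : ℕ => (i : ℤ) - j)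
    (fun a b h => by simpa using h) fun n : ℤ => ENNReal.ofReal (r ^ n.natAbs)

/-- Schur's test on `ℓ^q`. -/
theorem tsum_tsum_mul_rpow_le {q : ℝ} (hq : 1 < q) (K : ℕ → ℕ → ℝ≥0∞) (a : ℕ → ℝ≥0∞) (B : ℝ≥0∞)
    (hrow : ∀ i, ∑' j, K i j ≤ B) (hcol : ∀ j, ∑' i, K i j ≤ B) :
    ∑' i, (∑' j, K i j * a j) ^ q ≤ B ^ q * ∑' j, a j ^ q := by
  have hc := Real.HolderConjugate.conjExponent hq
  have hq0 : 0 < q := by linarith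
  set q' := q.conjExponent
  have hq'0 : 0 < q' := hc.symm.pos
  -- Hölder for counting measure after splitting K = K^(1/q) K^(1/q'); the row sums control the
  -- second factor, and the column sums enter after exchanging the sums.
  have h1 : ∀ i, (∑' j, K i j * a j) ^ q ≤ B ^ (q - 1) * ∑' j, K i j * a j ^ q := by
    intro i
    have h := ENNReal.lintegral_mul_le_Lp_mul_Lq Measure.count hc
      (f := fun j => K i j ^ (1 / q) * a j) (g := fun j => K i j ^ (1 / q'))
      (measurable_of_countable _).aemeasurable (measurable_of_countable _).aemeasurable
    simp only [lintegral_count, Pi.mul_apply] at h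
    have e1 : ∀ j, K i j ^ (1 / q) * a j * K i j ^ (1 / q') = K i j * a j := by
      intro j
      rw [mul_right_comm, ← ENNReal.rpow_add_of_nonneg _ _ (by positivity) (by positivity)]
      have : 1 / q + 1 / q' = 1 := by rw [one_div, one_div, hc.inv_add_inv_eq_one]
      rw [this, ENNReal.rpow_one]
    have e2 : ∀ j, (K i j ^ (1 / q) * a j) ^ q = K i j * a j ^ q := by
      intro j
      rw [ENNReal.mul_rpow_of_nonneg _ _ hq0.le, ← ENNReal.rpow_mul, one_div_mul_cancel hq0.ne',
        ENNReal.rpow_one]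
    have e3 : ∀ j, (K i j ^ (1 / q')) ^ q' = K i j := by
      intro j
      rw [← ENNReal.rpow_mul, one_div_mul_cancel hq'0.ne', ENNReal.rpow_one]
    simp_rw [e1, e2, e3] at h
    calc (∑' j, K i j * a j) ^ q
        ≤ ((∑' j, K i j * a j ^ q) ^ (1 / q) * (∑' j, K i j) ^ (1 / q')) ^ q := by gcongr
      _ ≤ ((∑' j, K i j * a j ^ q) ^ (1 / q) * B ^ (1 / q')) ^ q := by
          gcongr
          exact hrow i
      _ = _ := by
          rw [ENNReal.mul_rpow_of_nonneg _ _ hq0.le, ← ENNReal.rpow_mul, ← ENNReal.rpow_mul,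
            one_div_mul_cancel hq0.ne', ENNReal.rpow_one, mul_comm]
          congr 2
          have := hc.inv_add_inv_eq_one
          have h5 : q'⁻¹ = 1 - q⁻¹ := by linarith
          rw [one_div, h5]
          field_simp
  calc _ ≤ ∑' i, B ^ (q - 1) * ∑' j, K i j * a j ^ q := ENNReal.tsum_le_tsum h1
    _ = B ^ (q - 1) * ∑' j, (∑' i, K i j) * a j ^ q := by
        rw [ENNReal.tsum_mul_left, ENNReal.tsum_comm]
        simp_rw [ENNReal.tsum_mul_right]
    _ ≤ B ^ (q - 1) * ∑' j, B * a j ^ q := by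
        gcongr with j
        exact hcol j
    _ = B ^ (q - 1) * B ^ (1 : ℝ) * ∑' j, a j ^ q := by
        rw [ENNReal.tsum_mul_left, ENNReal.rpow_one, mul_assoc]
    _ = _ := by
        rw [← ENNReal.rpow_add_of_nonneg _ _ (by linarith) (by norm_num)]
        ring_nf

/-- The inclusion ℓ^p ⊂ ℓ^q: each a_j^p is at most the full sum S, so a_j^q = (a_j^p)^(q/p-1) a_j^p
≤ S^(q/p-1) a_j^p. -/
theorem tsum_rpow_le_rpow_tsum {p q : ℝ} (hp : 0 < p) (hpq : p ≤ q) (a : ℕ → ℝ≥0∞) :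
    ∑' j, a j ^ q ≤ (∑' j, a j ^ p) ^ (q / p) := by
  set S := ∑' j, a j ^ p with hS
  have h : ∀ j, a j ^ q ≤ S ^ (q / p - 1) * a j ^ p := by
    intro j
    have h1 : a j ^ p ≤ S := ENNReal.le_tsum j
    calc a j ^ q = (a j ^ p) ^ (q / p - 1) * (a j ^ p) ^ (1 : ℝ) := by
          rw [← ENNReal.rpow_add_of_nonneg _ _ _ (by norm_num), ← ENNReal.rpow_mul]
          · congr 1; field_simp; ring
          · rw [sub_nonneg, one_le_div hp]; exact hpq
      _ ≤ _ := by
          rw [ENNReal.rpow_one]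
          gcongr
          rw [sub_nonneg, one_le_div hp]; exact hpq
  calc _ ≤ ∑' j, S ^ (q / p - 1) * a j ^ p := ENNReal.tsum_le_tsum h
    _ = S ^ (q / p - 1) * S ^ (1 : ℝ) := by rw [ENNReal.tsum_mul_left, ENNReal.rpow_one]
    _ = _ := by
      rw [← ENNReal.rpow_add_of_nonneg _ _ _ (by norm_num)]
      · ring_nf
      · rw [sub_nonneg, one_le_div hp]; exact hpq

/-! ### Bergman norms and Carleson conditions in dyadic form. -/

theorem bergmanNorm_eq (p α : ℝ) (f : ℂ → ℂ) :
    bergmanNorm p α f = (ENNReal.ofReal ((α + 1) / Real.pi) *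
      ∫⁻ z, ENNReal.ofReal (‖f z‖ ^ p) ∂weightedArea α) ^ (1 / p) := by
  rw [bergmanNorm, lintegral_weightedArea]
  congr 3
  ext z
  rw [ENNReal.ofReal_mul (by positivity), mul_comm]

theorem ofReal_bergman_const_ne_zero {α : ℝ} (hα : -1 < α) :
    ENNReal.ofReal ((α + 1) / Real.pi) ≠ 0 := by
  have : 0 < (α + 1) / Real.pi := div_pos (by linarith) Real.pi_pos
  simpa using this

theorem MemBergman.lintegral_lt_top {p α : ℝ} {f : ℂ → ℂ} (hα : -1 < α) (hp : 0 < p)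
    (h : MemBergman p α f) : ∫⁻ z, ENNReal.ofReal (‖f z‖ ^ p) ∂weightedArea α < ∞ := by
  have h1 := h.2
  rw [bergmanNorm_eq, ENNReal.rpow_lt_top_iff_of_pos (by positivity)] at h1
  exact ENNReal.lt_top_of_mul_ne_top_right h1.ne (ofReal_bergman_const_ne_zero hα)

section Carleson

variable {μ : Measure (Set.Ico (0 : ℝ) 1)} {s : ℝ}

theorem Ici_zero_Ico : Set.Ici (⟨0, by simp⟩ : Set.Ico (0 : ℝ) 1) = Set.univ :=
  Set.eq_univ_of_forall fun t => t.2.1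

theorem IsCarleson.isFiniteMeasure (h : IsCarleson μ s) : IsFiniteMeasure μ := by
  obtain ⟨C, -, hC⟩ := h
  refine ⟨?_⟩
  have := hC ⟨0, by simp⟩
  rw [Ici_zero_Ico] at this
  exact this.trans_lt ENNReal.ofReal_lt_top

theorem IsCarleson.exists_measure_dyadicInterval_le (h : IsCarleson μ s) :
    ∃ C : ℝ, 0 < C ∧ ∀ j, μ (dyadicInterval j) ≤ ENNReal.ofReal (C * ((1 / 2 : ℝ) ^ j) ^ s) := by
  obtain ⟨C, hC0, hC⟩ := h
  refine ⟨C, hC0, fun j => (measure_mono (dyadicInterval_subset_Ici j)).trans ?_⟩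
  have := hC (dyadicPoint j)
  rwa [one_sub_dyadicPoint] at this

theorem log_two_div_half_pow (j : ℕ) :
    Real.log (2 / (1 / 2 : ℝ) ^ j) = (j + 1) * Real.log 2 := by
  have : (2 : ℝ) / (1 / 2) ^ j = 2 ^ (j + 1) := by
    rw [one_div, inv_pow, div_inv_eq_mul]; ring
  rw [this, Real.log_pow]
  push_cast
  ring

theorem IsLogCarleson.isCarleson (h : IsLogCarleson μ 1 s) : IsCarleson μ s := by
  obtain ⟨C, hC0, hC⟩ := h
  have hl : 0 < Real.log 2 := Real.log_pos (by norm_num)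
  refine ⟨C / Real.log 2, by positivity, fun t => ?_⟩
  have ht1 : 0 < 1 - (t : ℝ) := by linarith [t.2.2]
  have h1 : Real.log 2 ≤ Real.log (2 / (1 - (t : ℝ))) := by
    apply Real.log_le_log (by norm_num)
    rw [le_div_iff₀ ht1]
    linarith [t.2.1]
  have h2 : μ (Set.Ici t) * ENNReal.ofReal (Real.log 2) ≤
      ENNReal.ofReal (C * (1 - (t : ℝ)) ^ s) := by
    refine le_trans ?_ (hC t)
    rw [Real.rpow_one]
    gcongr
  rw [div_mul_eq_mul_div, ENNReal.ofReal_div_of_pos hl,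
    ENNReal.le_div_iff_mul_le (by simp [hl]) (by simp)]
  exact h2

theorem IsLogCarleson.exists_mul_measure_dyadicInterval_le (h : IsLogCarleson μ 1 s) :
    ∃ C : ℝ, 0 < C ∧ ∀ j : ℕ, ((j : ℝ≥0∞) + 1) * μ (dyadicInterval j) ≤
      ENNReal.ofReal (C * ((1 / 2 : ℝ) ^ j) ^ s) := by
  obtain ⟨C, hC0, hC⟩ := h
  have hl : 0 < Real.log 2 := Real.log_pos (by norm_num)
  refine ⟨C / Real.log 2, by positivity, fun j => ?_⟩
  have h1 := hC (dyadicPoint j)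
  rw [one_sub_dyadicPoint, log_two_div_half_pow, Real.rpow_one,
    ENNReal.ofReal_mul (by positivity)] at h1
  rw [div_mul_eq_mul_div, ENNReal.ofReal_div_of_pos hl,
    ENNReal.le_div_iff_mul_le (by simp [hl]) (by simp)]
  refine le_trans ?_ h1
  rw [mul_comm _ (μ _), mul_assoc]
  gcongr
  · exact dyadicInterval_subset_Ici j
  · rw [ENNReal.ofReal_add (by positivity) (by norm_num)]; simp

theorem isCarleson_of_dyadicPoint (hs : 0 ≤ s) {K : ℝ≥0∞} (hK : K ≠ ∞)
    (h : ∀ N, μ (Set.Ici (dyadicPoint N)) ≤ K * ENNReal.ofReal (((1 / 2 : ℝ) ^ N) ^ s)) :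
    IsCarleson μ s := by
  refine ⟨(K.toReal + 1) * 2 ^ s, by positivity, fun t => ?_⟩
  obtain ⟨N, hN⟩ := exists_mem_dyadicInterval t
  have hN1 := hN.1
  rw [pow_succ] at hN1
  have ht1 : 0 < 1 - (t : ℝ) := by linarith [t.2.2]
  calc μ (Set.Ici t) ≤ μ (Set.Ici (dyadicPoint N)) :=
        measure_mono (Set.Ici_subset_Ici.2 (dyadicInterval_subset_Ici N hN))
    _ ≤ _ := h N
    _ ≤ ENNReal.ofReal (K.toReal + 1) * ENNReal.ofReal ((2 * (1 - (t : ℝ))) ^ s) := by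
        gcongr
        · rw [ENNReal.le_ofReal_iff_toReal_le hK (by positivity)]
          linarith
        · linarith
    _ = _ := by
        rw [← ENNReal.ofReal_mul (by positivity), Real.mul_rpow (by norm_num) ht1.le, mul_assoc]

theorem isLogCarleson_of_dyadicPoint (hs : 0 ≤ s) {K : ℝ≥0∞} (hK : K ≠ ∞)
    (h : ∀ N : ℕ, ((N : ℝ≥0∞) + 1) * μ (Set.Ici (dyadicPoint N)) ≤
      K * ENNReal.ofReal (((1 / 2 : ℝ) ^ N) ^ s)) :
    IsLogCarleson μ 1 s := by
  refine ⟨2 * ((K.toReal + 1) * 2 ^ s), by positivity, fun t => ?_⟩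
  obtain ⟨N, hN⟩ := exists_mem_dyadicInterval t
  have hN1 := hN.1
  have ht1 : 0 < 1 - (t : ℝ) := by linarith [t.2.2]
  -- Since 1 - t > 2^(-N-1), the logarithm is at most (N + 2) log 2, and log 2 < 1.
  have hlog : Real.log (2 / (1 - (t : ℝ))) ≤ 2 * (N + 1) := by
    calc _ ≤ Real.log (2 / (1 / 2 : ℝ) ^ (N + 1)) := by
          apply Real.log_le_log (by positivity)
          gcongr
      _ = ((N + 1 : ℕ) + 1) * Real.log 2 := log_two_div_half_pow _
      _ ≤ ((N + 1 : ℕ) + 1) * 1 := by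
          gcongr
          linarith [Real.log_two_lt_d9]
      _ ≤ _ := by push_cast; linarith [(Nat.cast_nonneg N : (0 : ℝ) ≤ N)]
  rw [pow_succ] at hN1
  rw [Real.rpow_one]
  calc μ (Set.Ici t) * ENNReal.ofReal (Real.log (2 / (1 - (t : ℝ))))
      ≤ μ (Set.Ici (dyadicPoint N)) * ENNReal.ofReal (2 * (N + 1)) := by
        gcongr
        exact dyadicInterval_subset_Ici N hN
    _ = 2 * (((N : ℝ≥0∞) + 1) * μ (Set.Ici (dyadicPoint N))) := by
        rw [ENNReal.ofReal_mul (by norm_num), ENNReal.ofReal_add (by positivity) (by norm_num)]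
        simp only [ENNReal.ofReal_natCast, ENNReal.ofReal_one, ENNReal.ofReal_ofNat]
        ring
    _ ≤ 2 * (K * ENNReal.ofReal (((1 / 2 : ℝ) ^ N) ^ s)) := mul_le_mul_right (h N) _
    _ ≤ 2 * (ENNReal.ofReal (K.toReal + 1) * ENNReal.ofReal ((2 * (1 - (t : ℝ))) ^ s)) := by
        gcongr
        · rw [ENNReal.le_ofReal_iff_toReal_le hK (by positivity)]
          linarith
        · linarith
    _ = _ := by
        rw [← ENNReal.ofReal_mul (by positivity), Real.mul_rpow (by norm_num) ht1.le,
          ← ENNReal.ofReal_ofNat 2, ← ENNReal.ofReal_mul (by norm_num)]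
        ring_nf

/-- If `f` is area integrable with weight `(1 - |z|²)^(s-2)`, then the power series of `f` converges
absolutely in `L¹(μ)` for every `s`-Carleson measure `μ`. -/
theorem IsCarleson.lintegral_coeffMajorant_lt_top (h : IsCarleson μ s) {f : ℂ → ℂ}
    (hf : DifferentiableOn ℂ f (Metric.ball 0 1))
    (hI : ∫⁻ z, ENNReal.ofReal ‖f z‖ ∂weightedArea (s - 2) < ∞) :
    ∫⁻ t, coeffMajorant f (t : ℝ) ∂μ < ∞ := by
  obtain ⟨C, hC0, hC⟩ := h.exists_measure_dyadicInterval_le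
  set I : ℕ → ℝ≥0∞ := fun j => ∫⁻ w in dyadicAnnulus j, ENNReal.ofReal ‖f w‖ with hIdef
  have hx : ∀ j : ℕ, 0 < (1 / 2 : ℝ) ^ j := half_pow_pos
  -- With x = 2^(-j-1), the majorant costs x^(-2) and the measure of the j-th interval gives x^s up
  -- to constants. The product x^(s-2) is the weight on annulus j + 1, and bounded overlap sums the
  -- pieces.
  calc ∫⁻ t, coeffMajorant f (t : ℝ) ∂μ
      ≤ ∑' j, (ENNReal.ofReal ((((1 / 2 : ℝ) ^ (j + 1)) ^ 2)⁻¹) * (3 * I (j + 1))) *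
          μ (dyadicInterval j) := by
        apply lintegral_le_tsum_dyadicInterval
        intro j t ht
        have h1 := coeffMajorant_mul_le_setLIntegral hf t.2.1 ht.1
        have hj := hx (j + 1)
        rw [ENNReal.ofReal_inv_of_pos (by positivity), mul_comm, ← div_eq_mul_inv,
          ENNReal.le_div_iff_mul_le (by simp) (by simp)]
        exact h1
    _ ≤ ∑' j, ENNReal.ofReal (C * 2 ^ s) * 3 * ENNReal.ofReal (4 ^ |s - 2|) *
          ∫⁻ w in dyadicAnnulus (j + 1), ENNReal.ofReal ‖f w‖ ∂weightedArea (s - 2) := by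
        refine ENNReal.tsum_le_tsum fun j => ?_
        have hj := hx (j + 1)
        have e : (1 / 2 : ℝ) ^ j = 2 * (1 / 2) ^ (j + 1) := by rw [pow_succ]; ring
        set x := (1 / 2 : ℝ) ^ (j + 1)
        calc _ ≤ ENNReal.ofReal ((x ^ 2)⁻¹) * (3 * I (j + 1)) * ENNReal.ofReal (C * (2 * x) ^ s) := by
              gcongr
              rw [← e]; exact hC j
          _ = ENNReal.ofReal (C * 2 ^ s) * 3 * (ENNReal.ofReal (x ^ (s - 2)) * I (j + 1)) := by
              have e2 : ENNReal.ofReal ((x ^ 2)⁻¹) * ENNReal.ofReal (C * (2 * x) ^ s) =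
                  ENNReal.ofReal (C * 2 ^ s) * ENNReal.ofReal (x ^ (s - 2)) := by
                rw [← ENNReal.ofReal_mul (by positivity), ← ENNReal.ofReal_mul (by positivity),
                  Real.mul_rpow (by norm_num) hj.le, Real.rpow_sub hj]
                norm_cast
                congr 1
                field_simp
              calc _ = ENNReal.ofReal ((x ^ 2)⁻¹) * ENNReal.ofReal (C * (2 * x) ^ s) *
                    (3 * I (j + 1)) := by ring
                _ = _ := by rw [e2]; ring
          _ ≤ ENNReal.ofReal (C * 2 ^ s) * 3 * (ENNReal.ofReal (4 ^ |s - 2|) *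
              ∫⁻ w in dyadicAnnulus (j + 1), ENNReal.ofReal ‖f w‖ ∂weightedArea (s - 2)) := by
              exact mul_le_mul_right (rpow_mul_setLIntegral_dyadicAnnulus_le _ _ _) _
          _ = _ := by ring
    _ ≤ ENNReal.ofReal (C * 2 ^ s) * 3 * ENNReal.ofReal (4 ^ |s - 2|) *
          (3 * ∫⁻ w, ENNReal.ofReal ‖f w‖ ∂weightedArea (s - 2)) := by
        rw [ENNReal.tsum_mul_left]
        gcongr
        refine le_trans ?_ (tsum_setLIntegral_dyadicAnnulus_le _ _)
        exact ENNReal.tsum_comp_le_tsum_of_injective (add_left_injective 1) _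
    _ < ∞ := by finiteness

end Carleson

/-! ### Reduction of boundedness to a discrete estimate. -/

/-- Discretization of the size of a Bergman space function on `[0, 1)`. -/
theorem exists_dyadic_bound {f : ℂ → ℂ} {p α : ℝ} (hp : 0 < p) (hα : -2 ≤ α)
    (hf : DifferentiableOn ℂ f (Metric.ball 0 1)) :
    ∃ d : ℕ → ℝ≥0∞, (∀ j, ∀ t ∈ dyadicInterval j,
      ‖f (t : ℝ)‖ₑ ≤ d j * ENNReal.ofReal (((1 / 2 : ℝ) ^ j) ^ (-((α + 2) / p)))) ∧
      ∑' j, d j ^ p ≤ ENNReal.ofReal (2 ^ (α + 2) * (4 ^ |α| * 2)) * 3 *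
        ∫⁻ z, ENNReal.ofReal (‖f z‖ ^ p) ∂weightedArea α := by
  set C := ENNReal.ofReal (2 ^ (α + 2) * (4 ^ |α| * 2))
  -- d_j is, up to a constant, the L^p norm of f on annulus j, so the ℓ^p bound is just bounded
  -- overlap.
  refine ⟨fun j => (C * ∫⁻ w in dyadicAnnulus j, ENNReal.ofReal (‖f w‖ ^ p) ∂weightedArea α) ^ (1 / p),
    fun j t ht => ?_, ?_⟩
  · have hn : ‖((t : ℝ) : ℂ)‖ = t := by rw [Complex.norm_real, Real.norm_of_nonneg t.2.1]
    have h := norm_rpow_mul_le_setLIntegral_dyadicAnnulus (z := (t : ℝ)) (j := j) hp hα hf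
      (by rw [hn]; exact ht.1) (by rw [hn]; exact ht.2)
    have hj := half_pow_pos j
    set x := (1 / 2 : ℝ) ^ j
    calc ‖f (t : ℝ)‖ₑ = ENNReal.ofReal ((‖f (t : ℝ)‖ ^ p * x ^ (α + 2)) ^ (1 / p)) *
          ENNReal.ofReal (x ^ (-((α + 2) / p))) := by
          rw [← ENNReal.ofReal_mul (by positivity), Real.mul_rpow (by positivity) (by positivity),
            ← Real.rpow_mul (norm_nonneg _), ← Real.rpow_mul hj.le, mul_assoc, ← Real.rpow_add hj,
            mul_one_div_cancel hp.ne', mul_one_div, add_neg_cancel, Real.rpow_zero, mul_one,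
            Real.rpow_one, ofReal_norm]
      _ ≤ _ := by
          gcongr
          rw [← ENNReal.ofReal_rpow_of_nonneg (by positivity) (by positivity)]
          exact ENNReal.rpow_le_rpow h (by positivity)
  · simp_rw [← ENNReal.rpow_mul, one_div_mul_cancel hp.ne', ENNReal.rpow_one]
    rw [ENNReal.tsum_mul_left, mul_assoc]
    gcongr
    exact tsum_setLIntegral_dyadicAnnulus_le _ _

theorem norm_kernel (β : ℝ) (w : ℂ) :
    ‖1 / (1 - w) ^ (β : ℂ)‖ = ‖1 - w‖ ^ (-β) := by
  rw [norm_div, norm_one, Real.rpow_neg (norm_nonneg _), one_div]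
  congr 1
  exact Complex.norm_cpow_real _ _

/-- Both variables are discretized at once: t by dyadic intervals and z by shells around 1. On each
block |1 - tz| is at least half the larger of 2^(-i) and 2^(-j). -/
theorem lintegral_hilbertIntegral_rpow_le {μ : Measure (Set.Ico (0 : ℝ) 1)} {f : ℂ → ℂ}
    {α β q : ℝ} (hα : -1 < α) (hβ : 0 < β) (hq : 0 < q) (m : ℕ → ℝ≥0∞)
    (hm : ∀ j, ∀ t ∈ dyadicInterval j, ‖f (t : ℝ)‖ₑ ≤ m j) :
    ∫⁻ z, ENNReal.ofReal (‖hilbertIntegral μ β f z‖ ^ q) ∂weightedArea α ≤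
      ENNReal.ofReal (2 ^ |α| * (4 * Real.pi) / (α + 1) * 2 ^ (α + 2)) *
        ∑' i : ℕ, (∑' j : ℕ, m j * ENNReal.ofReal (2 ^ β *
          (max ((1 / 2 : ℝ) ^ i) ((1 / 2) ^ j)) ^ (-β)) * μ (dyadicInterval j)) ^ q *
          ENNReal.ofReal (((1 / 2 : ℝ) ^ i) ^ (α + 2)) := by
  apply lintegral_weightedArea_le_tsum hα
  intro i z hz hiz
  rw [mem_ball_zero_iff] at hz
  rw [← ENNReal.ofReal_rpow_of_nonneg (norm_nonneg _) hq.le, ofReal_norm]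
  gcongr
  refine (enorm_integral_le_lintegral_enorm _).trans ?_
  apply lintegral_le_tsum_dyadicInterval
  intro j t ht
  rw [enorm_mul]
  gcongr
  · exact hm j t ht
  · rw [← ofReal_norm, norm_kernel β]
    apply ENNReal.ofReal_le_ofReal
    have hj := half_pow_pos j
    have ht1 := ht.1
    rw [pow_succ] at ht1
    have h := half_mul_max_le_norm_one_sub (t := t) hz (by linarith) hiz.le
      (y := (1 / 2) ^ j)
    have hmax : 0 < max ((1 / 2 : ℝ) ^ i) ((1 / 2) ^ j) := lt_max_of_lt_right hj
    calc _ ≤ (max ((1 / 2 : ℝ) ^ i) ((1 / 2) ^ j) / 2) ^ (-β) :=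
          Real.rpow_le_rpow_of_nonpos (by positivity) h (by linarith)
      _ = _ := by
          rw [Real.div_rpow hmax.le (by norm_num), Real.rpow_neg (by norm_num : (0 : ℝ) ≤ 2)]
          field_simp

/-- Boundedness of the generalized Hilbert operator from an integral estimate. -/
theorem hilbertBounded_of_lintegral_le {μ : Measure (Set.Ico (0 : ℝ) 1)} [IsFiniteMeasure μ]
    {α β p q : ℝ} (hα : -1 < α) (hβ : 0 < β) (hp : 0 < p) (hq : 0 < q) {K : ℝ≥0∞} (hK : K ≠ ∞)
    (hA : ∀ f, MemBergman p α f → ∫⁻ t, coeffMajorant f (t : ℝ) ∂μ < ∞)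
    (h : ∀ f, MemBergman p α f →
      ∫⁻ z, ENNReal.ofReal (‖hilbertIntegral μ β f z‖ ^ q) ∂weightedArea α ≤
        K * (∫⁻ z, ENNReal.ofReal (‖f z‖ ^ p) ∂weightedArea α) ^ (q / p)) :
    HilbertBounded μ β p α q α := by
  have hA0 := ofReal_bergman_const_ne_zero hα
  set A := ENNReal.ofReal ((α + 1) / Real.pi) with hAdef
  have hAt : A ≠ ∞ := ENNReal.ofReal_ne_top
  have hfin : (A * K) ^ (1 / q) * A ^ (-(1 / p)) ≠ ∞ := by
    apply ENNReal.mul_ne_top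
    · exact ENNReal.rpow_ne_top_of_nonneg (by positivity) (ENNReal.mul_ne_top hAt hK)
    · exact ENNReal.rpow_ne_top_of_ne_zero hA0 hAt
  refine ⟨((A * K) ^ (1 / q) * A ^ (-(1 / p))).toNNReal, fun f hf => ?_⟩
  have himg := isHilbertImage_hilbertIntegral hβ hf.1 (hA f hf)
  have hle : bergmanNorm q α (hilbertIntegral μ β f) ≤
      (((A * K) ^ (1 / q) * A ^ (-(1 / p))).toNNReal : ℝ≥0∞) * bergmanNorm p α f := by
    rw [ENNReal.coe_toNNReal hfin, bergmanNorm_eq, bergmanNorm_eq, ← hAdef]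
    set I := ∫⁻ z, ENNReal.ofReal (‖f z‖ ^ p) ∂weightedArea α
    calc _ ≤ (A * (K * I ^ (q / p))) ^ (1 / q) := by
          gcongr
          exact h f hf
      _ = (A * K) ^ (1 / q) * I ^ (1 / p) := by
          rw [← mul_assoc, ENNReal.mul_rpow_of_nonneg _ _ (by positivity), ← ENNReal.rpow_mul]
          congr 2
          field_simp
      _ = _ := by
          rw [ENNReal.mul_rpow_of_nonneg A I (by positivity), ← mul_assoc, mul_assoc _ (A ^ (-(1 / p))),
            ← ENNReal.rpow_add _ _ hA0 hAt, neg_add_cancel, ENNReal.rpow_zero, mul_one]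
  exact ⟨_, himg, ⟨himg.analytic, hle.trans_lt (ENNReal.mul_lt_top ENNReal.coe_lt_top hf.2)⟩, hle⟩

/-! ### Sufficiency of the Carleson conditions. -/

section Sufficiency

variable {μ : Measure (Set.Ico (0 : ℝ) 1)} {α p q : ℝ}

theorem IsCarleson.lintegral_coeffMajorant_lt_top_of_le_one {s : ℝ} (hα : -1 < α) (hp : 0 < p)
    (hp1 : p ≤ 1) (hs : (α + 2) / p ≤ s) (hμ : IsCarleson μ s) {f : ℂ → ℂ}
    (hf : MemBergman p α f) : ∫⁻ t, coeffMajorant f (t : ℝ) ∂μ < ∞ :=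
  hμ.lintegral_coeffMajorant_lt_top hf.1 (lintegral_norm_lt_top_of_le_one (by linarith) hp hp1 hf.1
    (hf.lintegral_lt_top hα hp) (by linarith))

theorem IsCarleson.lintegral_coeffMajorant_lt_top_of_one_le {s : ℝ} (hα : -1 < α)
    (hp1 : 1 ≤ p) (hs : (α + 1) / p + 1 < s) (hμ : IsCarleson μ s) {f : ℂ → ℂ}
    (hf : MemBergman p α f) : ∫⁻ t, coeffMajorant f (t : ℝ) ∂μ < ∞ :=
  hμ.lintegral_coeffMajorant_lt_top hf.1 (lintegral_norm_lt_top_of_one_le hp1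
    (hf.lintegral_lt_top hα (by linarith)) (by linarith))

theorem hilbertBounded_of_isCarleson (hα : -1 < α) (hp : 0 < p) (hpq : p ≤ q) (hq : 1 < q)
    (hμ : IsCarleson μ ((α + 2) / p + (α + 2) / q.conjExponent)) :
    HilbertBounded μ (α + 2) p α q α := by
  have hc := Real.HolderConjugate.conjExponent hq
  have hq0 : 0 < q := by linarith
  set q' := q.conjExponent
  have hq'0 : 0 < q' := hc.symm.pos
  have hqq : 1 / q + 1 / q' = 1 := by rw [one_div, one_div, hc.inv_add_inv_eq_one]
  set β := α + 2 with hβdef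
  have hβ : 0 < β := by linarith
  have hββ : β / q + β / q' = β := by
    rw [div_eq_mul_one_div β q, div_eq_mul_one_div β q', ← mul_add, hqq, mul_one]
  have := hμ.isFiniteMeasure
  have hA : ∀ f, MemBergman p α f → ∫⁻ t, coeffMajorant f (t : ℝ) ∂μ < ∞ := by
    intro f hf
    rcases le_or_gt p 1 with hp1 | hp1
    · refine hμ.lintegral_coeffMajorant_lt_top_of_le_one hα hp hp1 ?_ hf
      have : 0 < β / q' := by positivity
      linarith
    -- The strict inequality comes from (α+1)/p < α + 1, together with β/q ≤ (α+1)/p + 1/p, which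
    -- uses p ≤ q.
    · refine hμ.lintegral_coeffMajorant_lt_top_of_one_le hα hp1.le ?_ hf
      have h1 : β / q ≤ β / p := by gcongr
      have h2 : β / p - (α + 1) / p = 1 / p := by rw [hβdef]; ring
      have h3 : (α + 1) / p < α + 1 := div_lt_self (by linarith) hp1
      have h4 : 1 / q ≤ 1 / p := by gcongr
      have h5 : β / q = (α + 1) / q + 1 / q := by rw [hβdef]; ring
      have h6 : (α + 1) / q ≤ (α + 1) / p := by
        have : 0 < α + 1 := by linarith
        gcongr
      linarith
  obtain ⟨C, hC0, hC⟩ := hμ.exists_measure_dyadicInterval_le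
  -- ε is the decay rate of the matrix away from the diagonal; it is positive only because q > 1
  -- makes q' finite.
  set ε := min (β / q) (β / q') with hε
  have hε0 : 0 < ε := lt_min (by positivity) (by positivity)
  set r := (1 / 2 : ℝ) ^ ε with hr
  have hr0 : 0 ≤ r := by positivity
  have hr1 : r < 1 := Real.rpow_lt_one (by norm_num) (by norm_num) hε0
  set B := twoSidedGeom r with hB
  have hBt : B < ∞ := twoSidedGeom_lt_top hr0 hr1
  set K₁ := ENNReal.ofReal (2 ^ |α| * (4 * Real.pi) / (α + 1) * 2 ^ β)
  set K₂ := ENNReal.ofReal (2 ^ β * (4 ^ |α| * 2))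
  refine hilbertBounded_of_lintegral_le hα hβ hp hq0
    (K := K₁ * (ENNReal.ofReal (2 ^ β * C) ^ q * (B ^ q * (K₂ * 3) ^ (q / p)))) ?_ hA ?_
  · have hp' : 0 ≤ q / p := by positivity
    finiteness
  intro f hf
  obtain ⟨d, hd1, hd2⟩ := exists_dyadic_bound (α := α) hp (by linarith) hf.1
  set I := ∫⁻ z, ENNReal.ofReal (‖f z‖ ^ p) ∂weightedArea α
  refine (lintegral_hilbertIntegral_rpow_le hα hβ hq0 _ hd1).trans ?_
  rw [mul_assoc]
  refine mul_le_mul_right ?_ _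
  -- The shell area 2^(-iβ) enters the q-th power as 2^(-iβ/q). The growth 2^(jβ/p) of f cancels the
  -- first part of the Carleson exponent and leaves 2^(-jβ/q'); since β/q + β/q' = β, the result is
  -- homogeneous of degree 0 with the kernel.
  have hterm : ∀ i j : ℕ, ENNReal.ofReal (((1 / 2 : ℝ) ^ i) ^ (β / q)) *
      (d j * ENNReal.ofReal (((1 / 2 : ℝ) ^ j) ^ (-(β / p))) * ENNReal.ofReal (2 ^ β *
          (max ((1 / 2 : ℝ) ^ i) ((1 / 2) ^ j)) ^ (-β)) * μ (dyadicInterval j)) ≤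
      ENNReal.ofReal (2 ^ β * C) * (ENNReal.ofReal (r ^ ((i : ℤ) - j).natAbs) * d j) := by
    intro i j
    have hi := half_pow_pos i
    have hj := half_pow_pos j
    have hk := half_pow_max_rpow_le (min_le_left (β / q) (β / q')) (min_le_right _ _) i j
    rw [hββ] at hk
    set x := (1 / 2 : ℝ) ^ i
    set y := (1 / 2 : ℝ) ^ j
    have hmax : 0 < max x y := lt_max_of_lt_right hj
    calc _ ≤ ENNReal.ofReal (x ^ (β / q)) * (d j * ENNReal.ofReal (y ^ (-(β / p))) *
            ENNReal.ofReal (2 ^ β * (max x y) ^ (-β)) *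
            ENNReal.ofReal (C * y ^ (β / p + β / q'))) := by
          gcongr
          exact hC j
      _ = d j * (ENNReal.ofReal (x ^ (β / q)) * ENNReal.ofReal (y ^ (-(β / p))) *
            ENNReal.ofReal (2 ^ β * (max x y) ^ (-β)) *
            ENNReal.ofReal (C * y ^ (β / p + β / q'))) := by ring
      _ = d j * ENNReal.ofReal (2 ^ β * C * (x ^ (β / q) * y ^ (β / q') * (max x y) ^ (-β))) := by
          rw [← ENNReal.ofReal_mul (by positivity), ← ENNReal.ofReal_mul (by positivity),
            ← ENNReal.ofReal_mul (by positivity)]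
          congr 2
          have : y ^ (-(β / p)) * y ^ (β / p + β / q') = y ^ (β / q') := by
            rw [← Real.rpow_add hj]; ring_nf
          rw [← this]; ring
      _ ≤ d j * ENNReal.ofReal (2 ^ β * C * r ^ ((i : ℤ) - j).natAbs) := by
          gcongr
      _ = _ := by
          rw [ENNReal.ofReal_mul (by positivity)]; ring
  have hsum : ∀ i : ℕ, (∑' j : ℕ, d j * ENNReal.ofReal (((1 / 2 : ℝ) ^ j) ^ (-(β / p))) *
      ENNReal.ofReal (2 ^ β * (max ((1 / 2 : ℝ) ^ i) ((1 / 2) ^ j)) ^ (-β)) *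
      μ (dyadicInterval j)) ^ q * ENNReal.ofReal (((1 / 2 : ℝ) ^ i) ^ β) ≤
      ENNReal.ofReal (2 ^ β * C) ^ q *
        (∑' j : ℕ, ENNReal.ofReal (r ^ ((i : ℤ) - j).natAbs) * d j) ^ q := by
    intro i
    have hi := half_pow_pos i
    have e : ENNReal.ofReal (((1 / 2 : ℝ) ^ i) ^ β) =
        ENNReal.ofReal (((1 / 2 : ℝ) ^ i) ^ (β / q)) ^ q := by
      rw [ENNReal.ofReal_rpow_of_nonneg (by positivity) hq0.le, ← Real.rpow_mul hi.le,
        div_mul_cancel₀ _ hq0.ne']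
    rw [e, ← ENNReal.mul_rpow_of_nonneg _ _ hq0.le, ← ENNReal.mul_rpow_of_nonneg _ _ hq0.le,
      mul_comm (∑' _, _), ← ENNReal.tsum_mul_left, ← ENNReal.tsum_mul_left]
    exact ENNReal.rpow_le_rpow (ENNReal.tsum_le_tsum (hterm i)) hq0.le
  calc _ ≤ ∑' i : ℕ, ENNReal.ofReal (2 ^ β * C) ^ q *
        (∑' j : ℕ, ENNReal.ofReal (r ^ ((i : ℤ) - j).natAbs) * d j) ^ q := ENNReal.tsum_le_tsum hsum
    _ ≤ ENNReal.ofReal (2 ^ β * C) ^ q * (B ^ q * ∑' j, d j ^ q) := by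
        rw [ENNReal.tsum_mul_left]
        exact mul_le_mul_right (tsum_tsum_mul_rpow_le hq _ _ _ (tsum_pow_natAbs_sub_le' r)
          (tsum_pow_natAbs_sub_le r)) _
    _ ≤ ENNReal.ofReal (2 ^ β * C) ^ q * (B ^ q * ((K₂ * 3) ^ (q / p) * I ^ (q / p))) := by
        have hp' : 0 ≤ q / p := by positivity
        gcongr
        rw [← ENNReal.mul_rpow_of_nonneg _ _ hp']
        exact (tsum_rpow_le_rpow_tsum hp hpq d).trans (ENNReal.rpow_le_rpow hd2 hp')
    _ = _ := by ring

/-- Source of the logarithm: each of the j + 1 terms with i ≤ j is at most 1, with no decay, while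
the terms with i > j are geometric. -/
theorem tsum_half_pow_max_le {β : ℝ} (hβ : 0 < β) (j : ℕ) :
    ∑' i : ℕ, ENNReal.ofReal (((1 / 2 : ℝ) ^ i) ^ β *
      (max ((1 / 2 : ℝ) ^ i) ((1 / 2) ^ j)) ^ (-β)) ≤
      (twoSidedGeom ((1 / 2 : ℝ) ^ β) + 1) * ((j : ℝ≥0∞) + 1) := by
  set r := (1 / 2 : ℝ) ^ β
  have hle : ∀ i : ℕ, ENNReal.ofReal (((1 / 2 : ℝ) ^ i) ^ β *
      (max ((1 / 2 : ℝ) ^ i) ((1 / 2) ^ j)) ^ (-β)) ≤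
      (if i ∈ Finset.range (j + 1) then 1 else 0) +
        ENNReal.ofReal (r ^ ((i : ℤ) - j).natAbs) := by
    intro i
    have hi := half_pow_pos i
    have hj := half_pow_pos j
    have hmax : 0 < max ((1 / 2 : ℝ) ^ i) ((1 / 2) ^ j) := lt_max_of_lt_right hj
    split_ifs with h
    · refine le_trans ?_ le_self_add
      rw [ENNReal.ofReal_le_one, Real.rpow_neg hmax.le, ← div_eq_mul_inv, div_le_one (by positivity)]
      gcongr
      exact le_max_left _ _
    · rw [zero_add]
      apply ENNReal.ofReal_le_ofReal
      rw [Finset.mem_range] at h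
      obtain ⟨k, rfl⟩ := Nat.exists_eq_add_of_le (show j ≤ i by lia)
      have hk := half_pow_pos k
      have e : (((j + k : ℕ) : ℤ) - j).natAbs = k := by simp
      have hm : max ((1 / 2 : ℝ) ^ (j + k)) ((1 / 2) ^ j) = (1 / 2) ^ j := by
        apply max_eq_right
        have : (1 / 2 : ℝ) ^ k ≤ 1 := pow_le_one₀ (by norm_num) (by norm_num)
        rw [pow_add]; nlinarith
      rw [e, hm, pow_add, Real.mul_rpow hj.le hk.le, mul_right_comm, ← Real.rpow_add hj,
        add_neg_cancel, Real.rpow_zero, one_mul, ← Real.rpow_natCast r, ← Real.rpow_mul (by norm_num),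
        mul_comm β, Real.rpow_mul (by norm_num), Real.rpow_natCast]
  calc _ ≤ ∑' i : ℕ, ((if i ∈ Finset.range (j + 1) then 1 else 0) +
        ENNReal.ofReal (r ^ ((i : ℤ) - j).natAbs)) := ENNReal.tsum_le_tsum hle
    _ ≤ ((j : ℝ≥0∞) + 1) + twoSidedGeom r := by
        rw [ENNReal.tsum_add]
        gcongr
        · rw [tsum_eq_sum (s := Finset.range (j + 1)) (fun b hb => if_neg hb),
            Finset.sum_congr rfl fun i hi => if_pos hi]
          simp
        · exact tsum_pow_natAbs_sub_le r j
    _ ≤ ((j : ℝ≥0∞) + 1) + twoSidedGeom r * ((j : ℝ≥0∞) + 1) := by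
        gcongr
        exact le_mul_of_one_le_right zero_le le_add_self
    _ = _ := by ring

/-- For q = 1 the sums over i and j can be exchanged. The inner sum costs j + 1, which the
logarithmic condition on the j-th interval compensates, leaving Σ d_j; this is controlled because
ℓ^p ⊂ ℓ¹ for p ≤ 1. -/
theorem hilbertBounded_of_isLogCarleson (hα : -1 < α) (hp : 0 < p) (hp1 : p ≤ 1)
    (hμ : IsLogCarleson μ 1 ((α + 2) / p)) : HilbertBounded μ (α + 2) p α 1 α := by
  set β := α + 2 with hβdef
  have hβ : 0 < β := by linarith
  have hμ' := hμ.isCarleson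
  have := hμ'.isFiniteMeasure
  obtain ⟨C, hC0, hC⟩ := hμ.exists_mul_measure_dyadicInterval_le
  set B := twoSidedGeom ((1 / 2 : ℝ) ^ β) + 1 with hB
  have hBt : B < ∞ := ENNReal.add_lt_top.2 ⟨twoSidedGeom_lt_top (by positivity)
    (Real.rpow_lt_one (by norm_num) (by norm_num) hβ), ENNReal.one_lt_top⟩
  set K₁ := ENNReal.ofReal (2 ^ |α| * (4 * Real.pi) / (α + 1) * 2 ^ β)
  set K₂ := ENNReal.ofReal (2 ^ β * (4 ^ |α| * 2))
  refine hilbertBounded_of_lintegral_le hα hβ hp one_pos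
    (K := K₁ * (ENNReal.ofReal (2 ^ β * C) * B * (K₂ * 3) ^ (1 / p))) ?_
    (fun f hf => hμ'.lintegral_coeffMajorant_lt_top_of_le_one hα hp hp1 le_rfl hf) ?_
  · have hp' : 0 ≤ 1 / p := by positivity
    clear_value B
    finiteness
  intro f hf
  obtain ⟨d, hd1, hd2⟩ := exists_dyadic_bound (α := α) hp (by linarith) hf.1
  set I := ∫⁻ z, ENNReal.ofReal (‖f z‖ ^ p) ∂weightedArea α
  refine (lintegral_hilbertIntegral_rpow_le hα hβ one_pos _ hd1).trans ?_
  rw [mul_assoc]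
  refine mul_le_mul_right ?_ _
  simp_rw [ENNReal.rpow_one, ← ENNReal.tsum_mul_right]
  rw [ENNReal.tsum_comm]
  have hterm : ∀ j : ℕ, ∑' i : ℕ, d j * ENNReal.ofReal (((1 / 2 : ℝ) ^ j) ^ (-(β / p))) *
      ENNReal.ofReal (2 ^ β * (max ((1 / 2 : ℝ) ^ i) ((1 / 2) ^ j)) ^ (-β)) *
      μ (dyadicInterval j) * ENNReal.ofReal (((1 / 2 : ℝ) ^ i) ^ β) ≤
      ENNReal.ofReal (2 ^ β * C) * B * d j := by
    intro j
    have hj := half_pow_pos j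
    set y := (1 / 2 : ℝ) ^ j
    have e : ∀ i : ℕ, d j * ENNReal.ofReal (y ^ (-(β / p))) *
        ENNReal.ofReal (2 ^ β * (max ((1 / 2 : ℝ) ^ i) y) ^ (-β)) *
        μ (dyadicInterval j) * ENNReal.ofReal (((1 / 2 : ℝ) ^ i) ^ β) =
        d j * ENNReal.ofReal (y ^ (-(β / p))) * ENNReal.ofReal (2 ^ β) * μ (dyadicInterval j) *
          ENNReal.ofReal (((1 / 2 : ℝ) ^ i) ^ β * (max ((1 / 2 : ℝ) ^ i) y) ^ (-β)) := by
      intro i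
      rw [ENNReal.ofReal_mul (p := 2 ^ β) (by positivity),
        ENNReal.ofReal_mul (p := ((1 / 2 : ℝ) ^ i) ^ β) (by positivity)]
      ring
    simp_rw [e]
    rw [ENNReal.tsum_mul_left]
    calc _ ≤ d j * ENNReal.ofReal (y ^ (-(β / p))) * ENNReal.ofReal (2 ^ β) *
          μ (dyadicInterval j) * (B * ((j : ℝ≥0∞) + 1)) := by
          gcongr
          exact tsum_half_pow_max_le hβ j
      _ = d j * B * ENNReal.ofReal (y ^ (-(β / p))) * ENNReal.ofReal (2 ^ β) *
          (((j : ℝ≥0∞) + 1) * μ (dyadicInterval j)) := by ring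
      _ ≤ d j * B * ENNReal.ofReal (y ^ (-(β / p))) * ENNReal.ofReal (2 ^ β) *
          ENNReal.ofReal (C * y ^ (β / p)) := mul_le_mul_right (hC j) _
      _ = d j * B * (ENNReal.ofReal (y ^ (-(β / p))) * ENNReal.ofReal (2 ^ β) *
          ENNReal.ofReal (C * y ^ (β / p))) := by ring
      _ = d j * B * ENNReal.ofReal (2 ^ β * C) := by
          rw [← ENNReal.ofReal_mul (by positivity), ← ENNReal.ofReal_mul (by positivity)]
          congr 2
          have : y ^ (-(β / p)) * y ^ (β / p) = 1 := by
            rw [← Real.rpow_add hj, neg_add_cancel, Real.rpow_zero]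
          calc _ = (y ^ (-(β / p)) * y ^ (β / p)) * (2 ^ β * C) := by ring
            _ = _ := by rw [this, one_mul]
      _ = _ := by ring
  calc _ ≤ ∑' j, ENNReal.ofReal (2 ^ β * C) * B * d j := ENNReal.tsum_le_tsum hterm
    _ ≤ ENNReal.ofReal (2 ^ β * C) * B * ((K₂ * 3) ^ (1 / p) * I ^ (1 / p)) := by
        rw [ENNReal.tsum_mul_left]
        gcongr
        rw [← ENNReal.mul_rpow_of_nonneg _ _ (by positivity)]
        have := tsum_rpow_le_rpow_tsum hp hp1 d
        simp_rw [ENNReal.rpow_one] at this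
        exact this.trans (ENNReal.rpow_le_rpow hd2 (by positivity))
    _ = _ := by ring

end Sufficiency

/-! ### Necessity, by test functions. -/

section Necessity

/-- The test function `(1 - a z)^(-M)` with `a = 1 - 2^(-N)`. -/
noncomputable def testFunction (M N : ℕ) (z : ℂ) : ℂ := ((1 - (dyadicPoint N : ℝ) * z) ^ M)⁻¹

/-- The radius 2/(1 + a) exceeds 1 and satisfies 2a/(1 + a) < 1, so the pole stays outside.
Analyticity beyond the closed disc makes the Taylor coefficients absolutely summable, so a finite
measure suffices for convergence. -/
theorem differentiableOn_testFunction (M N : ℕ) :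
    ∃ R, 1 < R ∧ DifferentiableOn ℂ (testFunction M N) (Metric.ball 0 R) := by
  set a := (dyadicPoint N : ℝ) with ha
  have ha0 : 0 ≤ a := (dyadicPoint N).2.1
  have ha1 : a < 1 := (dyadicPoint N).2.2
  refine ⟨2 / (1 + a), by rw [lt_div_iff₀ (by linarith)]; linarith, ?_⟩
  intro z hz
  rw [mem_ball_zero_iff, lt_div_iff₀ (by linarith)] at hz
  have hne : 1 - (a : ℂ) * z ≠ 0 := by
    intro h
    have h1 : ‖(a : ℂ) * z‖ = 1 := by rw [← sub_eq_zero.1 h, norm_one]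
    rw [norm_mul, Complex.norm_real, Real.norm_of_nonneg ha0] at h1
    nlinarith [norm_nonneg z]
  unfold testFunction
  rw [← ha]
  have : DifferentiableAt ℂ (fun z : ℂ => ((1 - (a : ℂ) * z) ^ M)⁻¹) z :=
    DifferentiableAt.inv (by fun_prop) (pow_ne_zero _ hne)
  exact this.differentiableWithinAt

theorem lintegral_coeffMajorant_testFunction_lt_top (μ : Measure (Set.Ico (0 : ℝ) 1))
    [IsFiniteMeasure μ] (M N : ℕ) :
    ∫⁻ t, coeffMajorant (testFunction M N) (t : ℝ) ∂μ < ∞ := by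
  obtain ⟨R, hR, hf⟩ := differentiableOn_testFunction M N
  have hs : Summable fun k => ‖taylorCoeffZero (testFunction M N) k‖ := by
    simpa using (hasSum_taylorCoeffZero hf (z := 1) (by simpa using hR)).summable.norm
  calc _ ≤ ∫⁻ t : Set.Ico (0 : ℝ) 1,
        ENNReal.ofReal (∑' k, ‖taylorCoeffZero (testFunction M N) k‖) ∂μ := by
        refine lintegral_mono fun t => ?_
        rw [ENNReal.ofReal_tsum_of_nonneg (fun _ => norm_nonneg _) hs]
        refine ENNReal.tsum_le_tsum fun k => ENNReal.ofReal_le_ofReal ?_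
        exact mul_le_of_le_one_right (norm_nonneg _) (pow_le_one₀ t.2.1 t.2.2.le)
    _ < ∞ := by
        rw [lintegral_const]
        finiteness

/-- Near 1 the function has size max(|1 - z|, 2^(-N))^(-M) up to constants. The condition on M makes
both exponents β and Mp - β at least β, so the sum over shells is geometric around i = N. -/
theorem lintegral_testFunction_rpow_le {α p : ℝ} (hα : -1 < α) {M : ℕ}
    (hM : 2 * (α + 2) ≤ M * p) : ∃ K : ℝ≥0∞, K ≠ ∞ ∧ ∀ N,
      ∫⁻ z, ENNReal.ofReal (‖testFunction M N z‖ ^ p) ∂weightedArea α ≤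
        K * ENNReal.ofReal (((1 / 2 : ℝ) ^ N) ^ (α + 2 - M * p)) := by
  set β := α + 2 with hβdef
  have hβ : 0 < β := by linarith
  set r := (1 / 2 : ℝ) ^ β with hr
  have hBt : twoSidedGeom r < ∞ := twoSidedGeom_lt_top (by positivity)
    (Real.rpow_lt_one (by norm_num) (by norm_num) hβ)
  set K₁ := ENNReal.ofReal (2 ^ |α| * (4 * Real.pi) / (α + 1) * 2 ^ β)
  refine ⟨K₁ * (ENNReal.ofReal (2 ^ (M * p)) * twoSidedGeom r), by finiteness, fun N => ?_⟩
  set y := (1 / 2 : ℝ) ^ N with hy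
  have hy0 : 0 < y := half_pow_pos N
  refine (lintegral_weightedArea_le_tsum hα _ (fun i => ENNReal.ofReal (2 ^ (M * p) *
    (max ((1 / 2 : ℝ) ^ i) y) ^ (-(M * p)))) ?_).trans ?_
  · intro i z hz hiz
    rw [mem_ball_zero_iff] at hz
    apply ENNReal.ofReal_le_ofReal
    have h := half_mul_max_le_norm_one_sub (t := dyadicPoint N) (y := y) hz
      (by rw [one_sub_dyadicPoint, ← hy]; linarith) hiz.le
    have hmax : 0 < max ((1 / 2 : ℝ) ^ i) y := lt_max_of_lt_right hy0
    have hpos : 0 < ‖1 - ((dyadicPoint N : ℝ) : ℂ) * z‖ := lt_of_lt_of_le (by positivity) h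
    rw [testFunction, norm_inv, norm_pow, Real.inv_rpow (by positivity), ← Real.rpow_natCast,
      ← Real.rpow_mul (norm_nonneg _), ← Real.rpow_neg (norm_nonneg _)]
    calc _ ≤ (max ((1 / 2 : ℝ) ^ i) y / 2) ^ (-(M * p)) :=
          Real.rpow_le_rpow_of_nonpos (by positivity) h (by linarith)
      _ = _ := by
          rw [Real.div_rpow hmax.le (by norm_num), Real.rpow_neg (by norm_num : (0 : ℝ) ≤ 2)]
          field_simp
  · rw [mul_assoc, mul_assoc]
    refine mul_le_mul_right ?_ _
    calc _ ≤ ∑' i : ℕ, ENNReal.ofReal (2 ^ (M * p)) * (ENNReal.ofReal (r ^ ((i : ℤ) - N).natAbs) *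
          ENNReal.ofReal (y ^ (β - M * p))) := by
          refine ENNReal.tsum_le_tsum fun i => ?_
          have hi := half_pow_pos i
          have hmax : 0 < max ((1 / 2 : ℝ) ^ i) y := lt_max_of_lt_right hy0
          have hk := half_pow_max_rpow_le (θ₁ := β) (θ₂ := M * p - β) (ε := β) le_rfl
            (by linarith) i N
          rw [← hy, add_sub_cancel] at hk
          rw [← ENNReal.ofReal_mul (by positivity), ← ENNReal.ofReal_mul (by positivity),
            ← ENNReal.ofReal_mul (by positivity)]
          apply ENNReal.ofReal_le_ofReal
          have e : y ^ (M * p - β) * y ^ (β - M * p) = 1 := by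
            rw [← Real.rpow_add hy0]; simp
          calc _ = 2 ^ (M * p) * ((((1 / 2 : ℝ) ^ i) ^ β * y ^ (M * p - β) *
                (max ((1 / 2 : ℝ) ^ i) y) ^ (-(M * p))) * y ^ (β - M * p)) := by
                calc _ = 2 ^ (M * p) * (max ((1 / 2 : ℝ) ^ i) y) ^ (-(M * p)) *
                      ((1 / 2 : ℝ) ^ i) ^ β * (y ^ (M * p - β) * y ^ (β - M * p)) := by
                      rw [e, mul_one]
                  _ = _ := by ring
            _ ≤ _ := by gcongr
      _ ≤ _ := by
          rw [ENNReal.tsum_mul_left, ENNReal.tsum_mul_right]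
          gcongr
          exact tsum_pow_natAbs_sub_le r N

/-- At a real point x = 1 - 2^(-j) the integrand is positive, so it may be restricted to t ≥ a.
There 1 - at ≤ 2(1 - a), and 1 - tx ≤ (1 - x) + (1 - a) ≤ 2(1 - x), which is where j ≤ N is used. -/
theorem le_enorm_hilbertIntegral_testFunction (μ : Measure (Set.Ico (0 : ℝ) 1)) [IsFiniteMeasure μ]
    {β : ℝ} (hβ : 0 < β) (M : ℕ) {j N : ℕ} (hjN : j ≤ N) :
    ENNReal.ofReal ((2 * (1 / 2 : ℝ) ^ N) ^ (-(M : ℝ)) * (2 * (1 / 2 : ℝ) ^ j) ^ (-β)) *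
      μ (Set.Ici (dyadicPoint N)) ≤
      ‖hilbertIntegral μ β (testFunction M N) ((dyadicPoint j : ℝ) : ℂ)‖ₑ := by
  obtain ⟨R, hR, hf⟩ := differentiableOn_testFunction M N
  have hA := lintegral_coeffMajorant_testFunction_lt_top μ M N
  set a := (dyadicPoint N : ℝ) with ha
  set x := (dyadicPoint j : ℝ) with hx
  have ha0 : 0 ≤ a := (dyadicPoint N).2.1
  have ha1 : a < 1 := (dyadicPoint N).2.2
  have hx0 : 0 ≤ x := (dyadicPoint j).2.1
  have hx1 : x < 1 := (dyadicPoint j).2.2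
  have hax : 1 - a ≤ 1 - x := by
    rw [one_sub_dyadicPoint, one_sub_dyadicPoint]
    exact pow_le_pow_of_le_one (by norm_num) (by norm_num) hjN
  set φ : Set.Ico (0 : ℝ) 1 → ℝ := fun t =>
    (1 - a * (t : ℝ)) ^ (-(M : ℝ)) * (1 - (t : ℝ) * x) ^ (-β) with hφ
  have hpos : ∀ t : Set.Ico (0 : ℝ) 1, 0 < 1 - a * (t : ℝ) ∧ 0 < 1 - (t : ℝ) * x := fun t => by
    have h0 := t.2.1
    have h1 := t.2.2
    constructor <;> nlinarith
  have hφ0 : ∀ t, 0 ≤ φ t := fun t =>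
    mul_nonneg (Real.rpow_nonneg (hpos t).1.le _) (Real.rpow_nonneg (hpos t).2.le _)
  have hint : ∀ t : Set.Ico (0 : ℝ) 1, testFunction M N ((t : ℝ) : ℂ) *
      (1 / (1 - ((t : ℝ) : ℂ) * (x : ℂ)) ^ (β : ℂ)) = (φ t : ℂ) := by
    intro t
    simp only [hφ, testFunction, ← ha]
    rw [Real.rpow_neg (hpos t).1.le, Real.rpow_neg (hpos t).2.le, Real.rpow_natCast, one_div]
    push_cast
    rw [Complex.ofReal_cpow (hpos t).2.le]
    push_cast
    rfl
  have hφm : Measurable φ := by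
    simp only [hφ]
    fun_prop
  have hφi : Integrable φ μ := by
    have hxβ : ∀ t : Set.Ico (0 : ℝ) 1, ‖φ t‖ ≤ (1 - a) ^ (-(M : ℝ)) * (1 - x) ^ (-β) := by
      intro t
      have h0 := t.2.1
      have h1 := t.2.2
      rw [Real.norm_of_nonneg (hφ0 t)]
      refine mul_le_mul ?_ ?_ (Real.rpow_nonneg (hpos t).2.le _)
        (Real.rpow_nonneg (by linarith) _)
      · exact Real.rpow_le_rpow_of_nonpos (by linarith) (by nlinarith) (by simp)
      · exact Real.rpow_le_rpow_of_nonpos (by linarith) (by nlinarith) (by linarith)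
    exact Integrable.of_bound hφm.aestronglyMeasurable _ (Eventually.of_forall hxβ)
  have hval : ‖hilbertIntegral μ β (testFunction M N) (x : ℂ)‖ₑ = ∫⁻ t, ENNReal.ofReal (φ t) ∂μ := by
    rw [hilbertIntegral]
    simp_rw [hint]
    have : ∫ t, (φ t : ℂ) ∂μ = ((∫ t, φ t ∂μ : ℝ) : ℂ) := integral_ofReal
    rw [this, ← ofReal_norm, Complex.norm_real, Real.norm_of_nonneg (integral_nonneg hφ0),
      ofReal_integral_eq_lintegral_ofReal hφi (Eventually.of_forall hφ0)]
  rw [hval, ← setLIntegral_const]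
  refine le_trans (setLIntegral_mono' measurableSet_Ici fun t ht => ?_)
    (setLIntegral_le_lintegral _ _)
  apply ENNReal.ofReal_le_ofReal
  have h0 := t.2.1
  have h1 := t.2.2
  have hat : a ≤ (t : ℝ) := ht
  rw [← one_sub_dyadicPoint N, ← one_sub_dyadicPoint j]
  refine mul_le_mul ?_ ?_ (Real.rpow_nonneg (by linarith) _) (Real.rpow_nonneg (hpos t).1.le _)
  · exact Real.rpow_le_rpow_of_nonpos (hpos t).1 (by nlinarith) (by simp)
  · exact Real.rpow_le_rpow_of_nonpos (hpos t).2 (by nlinarith) (by linarith)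

variable {μ : Measure (Set.Ico (0 : ℝ) 1)} {α p q : ℝ}

theorem memBergman_testFunction (hα : -1 < α) (hp : 0 < p) {M : ℕ} (hM : 2 * (α + 2) ≤ M * p)
    (N : ℕ) : MemBergman p α (testFunction M N) := by
  obtain ⟨R, hR, hf⟩ := differentiableOn_testFunction M N
  obtain ⟨K, hK, h⟩ := lintegral_testFunction_rpow_le hα hM
  refine ⟨hf.mono (Metric.ball_subset_ball hR.le), ?_⟩
  rw [bergmanNorm_eq, ENNReal.rpow_lt_top_iff_of_pos (by positivity)]
  refine ENNReal.mul_lt_top ENNReal.ofReal_lt_top ((h N).trans_lt ?_)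
  finiteness

/-- An image can exist only if the moments of μ are finite, and the moment of order 0 is its total
mass. The function tested is the constant 1, which is the case N = 0. -/
theorem HilbertBounded.isFiniteMeasure {β γ : ℝ} (hα : -1 < α) (hp : 0 < p)
    (h : HilbertBounded μ β p α q γ) : IsFiniteMeasure μ := by
  obtain ⟨C, hC⟩ := h
  obtain ⟨M, hM⟩ := exists_nat_ge (2 * (α + 2) / p)
  rw [div_le_iff₀ hp] at hM
  obtain ⟨g, hg, -⟩ := hC _ (memBergman_testFunction hα hp hM 0)
  have := hg.integrable_entry 0
  simp only [pow_zero] at this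
  rcases (integrable_const_iff).1 this with h | h
  · exact absurd h one_ne_zero
  · exact h

/-- Lower bound for the norm of a bounded generalized Hilbert operator on the test functions. -/
theorem HilbertBounded.exists_measure_Ici_le (hα : -1 < α) (hp : 0 < p) (hq : 0 < q)
    (h : HilbertBounded μ (α + 2) p α q α) : ∃ K : ℝ≥0∞, K ≠ ∞ ∧ ∀ N : ℕ,
      (∑ j ∈ Finset.range (N + 1), ENNReal.ofReal (((1 / 2 : ℝ) ^ j) ^ ((α + 2) * (1 - q)))) *
        μ (Set.Ici (dyadicPoint N)) ^ q ≤
      K * ENNReal.ofReal (((1 / 2 : ℝ) ^ N) ^ ((α + 2) / p * q)) := by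
  have := h.isFiniteMeasure hα hp
  obtain ⟨C, hC⟩ := h
  obtain ⟨M, hM⟩ := exists_nat_ge (2 * (α + 2) / p)
  rw [div_le_iff₀ hp] at hM
  obtain ⟨K₀, hK₀, hf⟩ := lintegral_testFunction_rpow_le hα hM
  have hA0 := ofReal_bergman_const_ne_zero hα
  set A := ENNReal.ofReal ((α + 1) / Real.pi) with hAdef
  have hAt : A ≠ ∞ := ENNReal.ofReal_ne_top
  set β := α + 2 with hβdef
  have hβ : 0 < β := by linarith
  set K₂ := ENNReal.ofReal (2 ^ β * (4 ^ |α| * 2))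
  set T := ENNReal.ofReal (2 ^ (((M : ℝ) + β) * q))
  have hqp : 0 ≤ q / p := by positivity
  refine ⟨T * (K₂ * (3 * (A⁻¹ * ((C : ℝ≥0∞) ^ q * (A * K₀) ^ (q / p))))), ?_, fun N => ?_⟩
  · have : A⁻¹ ≠ ∞ := ENNReal.inv_ne_top.2 hA0
    finiteness
  obtain ⟨g, hg, hgm, hgn⟩ := hC _ (memBergman_testFunction hα hp hM N)
  obtain ⟨R, hR, hfd⟩ := differentiableOn_testFunction M N
  have hA := lintegral_coeffMajorant_testFunction_lt_top μ M N
  set y := (1 / 2 : ℝ) ^ N with hy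
  have hy0 : 0 < y := half_pow_pos N
  have hgI : ∫⁻ z, ENNReal.ofReal (‖g z‖ ^ q) ∂weightedArea α ≤
      A⁻¹ * ((C : ℝ≥0∞) ^ q * ((A * K₀) ^ (q / p) * ENNReal.ofReal (y ^ (β / p * q - M * q)))) := by
    rw [bergmanNorm_eq, bergmanNorm_eq, ← hAdef] at hgn
    have h1 := ENNReal.rpow_le_rpow hgn hq.le
    rw [← ENNReal.rpow_mul, one_div_mul_cancel hq.ne', ENNReal.rpow_one,
      ENNReal.mul_rpow_of_nonneg _ _ hq.le, ← ENNReal.rpow_mul] at h1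
    rw [← ENNReal.mul_le_iff_le_inv hA0 hAt]
    refine h1.trans (mul_le_mul_right ?_ _)
    have e : 1 / p * q = q / p := by ring
    rw [e]
    calc _ ≤ (A * (K₀ * ENNReal.ofReal (y ^ (β - M * p)))) ^ (q / p) :=
          ENNReal.rpow_le_rpow (mul_le_mul_right (hf N) _) hqp
      _ = _ := by
          rw [← mul_assoc, ENNReal.mul_rpow_of_nonneg _ _ hqp,
            ENNReal.ofReal_rpow_of_nonneg (by positivity) hqp, ← Real.rpow_mul hy0.le]
          congr 4
          field_simp
  -- Sub-mean value estimate at 1 - 2^(-j), charged to annulus j only, so that all j ≤ N can later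
  -- be added at the cost of a factor 3. The power y^(Mq) offsets the size 2^(NM) of the test
  -- function.
  have hterm : ∀ j ∈ Finset.range (N + 1),
      ENNReal.ofReal (((1 / 2 : ℝ) ^ j) ^ (β * (1 - q))) * μ (Set.Ici (dyadicPoint N)) ^ q ≤
      T * ENNReal.ofReal (y ^ (M * q)) *
        (K₂ * ∫⁻ w in dyadicAnnulus j, ENNReal.ofReal (‖g w‖ ^ q) ∂weightedArea α) := by
    intro j hj
    have hjN : j ≤ N := by rw [Finset.mem_range] at hj; lia
    have hx0 := half_pow_pos j
    have hn : ‖((dyadicPoint j : ℝ) : ℂ)‖ = dyadicPoint j := by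
      rw [Complex.norm_real, Real.norm_of_nonneg (dyadicPoint j).2.1]
    have hm := dyadicPoint_mem j
    have h1 := norm_rpow_mul_le_setLIntegral_dyadicAnnulus (z := (dyadicPoint j : ℝ)) (j := j) hq
      (by linarith : -2 ≤ α) hgm.1 (by rw [hn]; exact hm.1) (by rw [hn]; exact hm.2)
    have hge : g ((dyadicPoint j : ℝ) : ℂ) =
        hilbertIntegral μ β (testFunction M N) ((dyadicPoint j : ℝ) : ℂ) :=
      hg.eq_hilbertIntegral hβ (hfd.mono (Metric.ball_subset_ball hR.le)) hA
        (by rw [mem_ball_zero_iff, hn]; exact (dyadicPoint j).2.2)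
    have h2 := le_enorm_hilbertIntegral_testFunction μ hβ M hjN
    rw [← hge, ← hy] at h2
    set x := (1 / 2 : ℝ) ^ j with hx
    refine le_trans ?_ (mul_le_mul_right h1 _)
    rw [ENNReal.ofReal_mul (by positivity), ← ENNReal.ofReal_rpow_of_nonneg (norm_nonneg _) hq.le,
      ofReal_norm]
    refine le_trans ?_ (mul_le_mul_right (mul_le_mul_left (ENNReal.rpow_le_rpow h2 hq.le) _) _)
    rw [ENNReal.mul_rpow_of_nonneg _ _ hq.le, ENNReal.ofReal_rpow_of_nonneg (by positivity) hq.le]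
    apply le_of_eq
    have e : x ^ (β * (1 - q)) = 2 ^ (((M : ℝ) + β) * q) * y ^ (M * q) *
        (((2 * y) ^ (-(M : ℝ)) * (2 * x) ^ (-β)) ^ q * x ^ β) := by
      have h2' : (0 : ℝ) < 2 := by norm_num
      rw [Real.mul_rpow (by positivity) (by positivity), ← Real.rpow_mul (by positivity),
        ← Real.rpow_mul (by positivity), Real.mul_rpow h2'.le hy0.le, Real.mul_rpow h2'.le hx0.le]
      have a1 : (2 : ℝ) ^ (((M : ℝ) + β) * q) * (2 ^ (-(M : ℝ) * q) * 2 ^ (-β * q)) = 1 := by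
        rw [← Real.rpow_add h2', ← Real.rpow_add h2']
        ring_nf
        simp
      have a2 : y ^ (M * q) * y ^ (-(M : ℝ) * q) = 1 := by
        rw [← Real.rpow_add hy0]
        ring_nf
        simp
      have a3 : x ^ (-β * q) * x ^ β = x ^ (β * (1 - q)) := by
        rw [← Real.rpow_add hx0]
        ring_nf
      calc x ^ (β * (1 - q)) = ((2 : ℝ) ^ (((M : ℝ) + β) * q) * (2 ^ (-(M : ℝ) * q) *
            2 ^ (-β * q))) * (y ^ (M * q) * y ^ (-(M : ℝ) * q)) * (x ^ (-β * q) * x ^ β) := by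
            rw [a1, a2, a3]; ring
        _ = _ := by ring
    rw [e, ENNReal.ofReal_mul (by positivity), ENNReal.ofReal_mul (by positivity),
      ENNReal.ofReal_mul (by positivity)]
    ring
  calc _ = ∑ j ∈ Finset.range (N + 1), ENNReal.ofReal (((1 / 2 : ℝ) ^ j) ^ (β * (1 - q))) *
        μ (Set.Ici (dyadicPoint N)) ^ q := Finset.sum_mul _ _ _
    _ ≤ ∑ j ∈ Finset.range (N + 1), T * ENNReal.ofReal (y ^ (M * q)) *
        (K₂ * ∫⁻ w in dyadicAnnulus j, ENNReal.ofReal (‖g w‖ ^ q) ∂weightedArea α) :=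
        Finset.sum_le_sum hterm
    _ ≤ T * ENNReal.ofReal (y ^ (M * q)) *
        (K₂ * (3 * ∫⁻ w, ENNReal.ofReal (‖g w‖ ^ q) ∂weightedArea α)) := by
        rw [← Finset.mul_sum, ← Finset.mul_sum]
        refine mul_le_mul_right (mul_le_mul_right ?_ _) _
        exact (ENNReal.sum_le_tsum _).trans (tsum_setLIntegral_dyadicAnnulus_le _ _)
    _ ≤ T * ENNReal.ofReal (y ^ (M * q)) * (K₂ * (3 * (A⁻¹ * ((C : ℝ≥0∞) ^ q *
        ((A * K₀) ^ (q / p) * ENNReal.ofReal (y ^ (β / p * q - M * q))))))) := by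
        refine mul_le_mul_right (mul_le_mul_right (mul_le_mul_right hgI _) _) _
    _ = T * (K₂ * (3 * (A⁻¹ * ((C : ℝ≥0∞) ^ q * (A * K₀) ^ (q / p))))) *
        (ENNReal.ofReal (y ^ (M * q)) * ENNReal.ofReal (y ^ (β / p * q - M * q))) := by ring
    _ = _ := by
        rw [← ENNReal.ofReal_mul (by positivity), ← Real.rpow_add hy0, add_sub_cancel]

/-- Only j = N is kept. Dividing and taking q-th roots leaves the exponent β/p - β(1 - q)/q = β/p +
β/q'. -/
theorem HilbertBounded.isCarleson (hα : -1 < α) (hp : 0 < p) (hq : 1 < q)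
    (h : HilbertBounded μ (α + 2) p α q α) :
    IsCarleson μ ((α + 2) / p + (α + 2) / q.conjExponent) := by
  have hq0 : 0 < q := by linarith
  have hc := Real.HolderConjugate.conjExponent hq
  have hq'0 : 0 < q.conjExponent := hc.symm.pos
  have hβ : 0 < α + 2 := by linarith
  obtain ⟨K, hK, h⟩ := h.exists_measure_Ici_le hα hp hq0
  refine isCarleson_of_dyadicPoint (K := K ^ (1 / q)) (by positivity)
    (ENNReal.rpow_ne_top_of_nonneg (by positivity) hK) fun N => ?_
  have hy0 := half_pow_pos N
  have h1 : ENNReal.ofReal (((1 / 2 : ℝ) ^ N) ^ ((α + 2) * (1 - q))) *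
      μ (Set.Ici (dyadicPoint N)) ^ q ≤
      K * ENNReal.ofReal (((1 / 2 : ℝ) ^ N) ^ ((α + 2) / p * q)) := by
    refine le_trans ?_ (h N)
    gcongr
    exact Finset.single_le_sum (f := fun j : ℕ =>
      ENNReal.ofReal (((1 / 2 : ℝ) ^ j) ^ ((α + 2) * (1 - q)))) (fun _ _ => zero_le)
      (Finset.self_mem_range_succ N)
  set y := (1 / 2 : ℝ) ^ N
  have hb : 0 < y ^ ((α + 2) * (1 - q)) := by positivity
  rw [mul_comm, ← ENNReal.le_div_iff_mul_le (by simp [hb]) (by simp), mul_div_assoc,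
    ← ENNReal.ofReal_div_of_pos hb, ← Real.rpow_sub hy0] at h1
  have h2 := ENNReal.rpow_le_rpow h1 (z := 1 / q) (by positivity)
  rw [← ENNReal.rpow_mul, mul_one_div_cancel hq0.ne', ENNReal.rpow_one,
    ENNReal.mul_rpow_of_nonneg _ _ (by positivity),
    ENNReal.ofReal_rpow_of_nonneg (by positivity) (by positivity), ← Real.rpow_mul hy0.le] at h2
  convert h2 using 4
  have h5 : (q.conjExponent)⁻¹ = 1 - q⁻¹ := by
    have := hc.inv_add_inv_eq_one
    linarith
  rw [div_eq_mul_inv (α + 2) q.conjExponent, h5]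
  field_simp
  ring

/-- At q = 1 every summand in the lower bound equals 1, so the sum is N + 1, comparable to the
logarithm at the point 1 - 2^(-N). -/
theorem HilbertBounded.isLogCarleson (hα : -1 < α) (hp : 0 < p)
    (h : HilbertBounded μ (α + 2) p α 1 α) : IsLogCarleson μ 1 ((α + 2) / p) := by
  have hβ : 0 < α + 2 := by linarith
  obtain ⟨K, hK, h⟩ := h.exists_measure_Ici_le hα hp one_pos
  refine isLogCarleson_of_dyadicPoint (by positivity) hK fun N => ?_
  simpa using h N

end Necessity

theorem theorem4p01 (p α : ℝ) (hp : 0 < p) (hα : -1 < α)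
    (μ : Measure (Set.Ico (0 : ℝ) 1)) (hμ : StandingCarleson μ p α) :
    (∀ q : ℝ, p ≤ q → 1 < q →
      (HilbertBounded μ (α + 2) p α q α ↔
        IsCarleson μ ((α + 2) / p + (α + 2) / q.conjExponent))) ∧
    (p ≤ 1 →
      (HilbertBounded μ (α + 2) p α 1 α ↔ IsLogCarleson μ 1 ((α + 2) / p))) :=
  ⟨fun _ hpq hq => ⟨fun h => h.isCarleson hα hp hq, hilbertBounded_of_isCarleson hα hp hpq hq⟩,
    fun hp1 => ⟨fun h => h.isLogCarleson hα hp, hilbertBounded_of_isLogCarleson hα hp hp1⟩⟩
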